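/- Let $[n]=\{1,\dots,n\}$. A flag of $[n]$ is a set $f$ of non-empty proper subsets of $[n]$ such that $X\subseteq Y$ or $Y\subseteq X$ for all $X,Y\in f$; its type is the set $\{|X| : X\in f\}$. For $T\subseteq[n-1]$ let $\mathcal F^T_n$ be the set of all flags of $[n]$ of type $T$, and let $\Gamma(n,T)$ be the graph with vertex set $\mathcal F^T_n$ in which two flags $f,g$ are adjacent if and only if they are in general position, that is, $X\cap Y=\emptyset$ or $X\cup Y=[n]$ for all $X\in f$ and $Y\in g$. For $X\subseteq[n]$ with $|X|\in T$ put $\mathcal F^{(T|X)}_n=\{f\in\mathcal F^T_n : X\in f\}$. For a group $G$ acting transitively on a set $V$, a block is a non-empty subset $\Delta\subseteq V$ such that for every $\alpha\in G$ either $\Delta^\alpha=\Delta$ or $\Delta^\alpha\cap\Delta=\emptyset$; it is nontrivial if it is neither a singleton nor $V$. A system of nontrivial blocks of $G$ is a set of the form $\{\Delta^\alpha : \alpha\in G\}$, where $\Delta$ is a nontrivial block. **Lemma.** Let $T=\{a,b\}\subseteq[n-1]$ with $a\le\frac n3-1$ and $b=\frac{2n}{3}$. Then the following hold. (i) The group $\mathrm{Aut}(\Gamma(n,T))$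 acts transitively on $\mathcal F^T_n$, and both $\Sigma=\{\mathcal F^{(T|A)}_n : A\subseteq[n],\ |A|=a\}$ and $\Omega=\{\mathcal F^{(T|B)}_n : B\subseteq[n],\ |B|=b\}$ are systems of nontrivial blocks of $\mathrm{Aut}(\Gamma(n,T))$ acting on $\mathcal F^T_n$. (ii) $\mathrm{Aut}(\Gamma(n,T))\cong S_n$. -/

import Mathlib

open scoped Pointwise

/-- A flag of `[n]` (modelled as `Fin n`): a set of non-empty proper subsets of `[n]`, any two of
which are comparable under inclusion. -/
def IsFlag {n : ℕ} (f : Finset (Finset (Fin n))) : Prop :=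
  (∀ A ∈ f, A.Nonempty ∧ A ≠ Finset.univ) ∧ ∀ A ∈ f, ∀ B ∈ f, A ⊆ B ∨ B ⊆ A

/-- The type of a flag: the set of cardinalities of its members. -/
def flagType {n : ℕ} (f : Finset (Finset (Fin n))) : Finset ℕ :=
  f.image Finset.card

/-- The set of all flags of `[n]` of type `T`. -/
def FlagOfType (n : ℕ) (T : Finset ℕ) : Type :=
  {f : Finset (Finset (Fin n)) // IsFlag f ∧ flagType f = T}

/-- Two flags of `[n]` are in general position if `A ∩ B = ∅` or `A ∪ B = [n]` for every member `A`
of the first and every member `B` of the second. -/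
def InGeneralPosition {n : ℕ} (f g : Finset (Finset (Fin n))) : Prop :=
  ∀ A ∈ f, ∀ B ∈ g, A ∩ B = ∅ ∨ A ∪ B = Finset.univ

/-- The general position graph of the flags of `[n]` of type `T`. The clause `f ≠ g` only
excludes a loop at the empty flag: a non-empty flag is never in general position with itself. -/
def generalPositionGraph (n : ℕ) (T : Finset ℕ) : SimpleGraph (FlagOfType n T) where
  Adj f g := f ≠ g ∧ InGeneralPosition f.1 g.1
  symm := ⟨fun f g h => ⟨h.1.symm, fun A hA B hB => by
    rw [Finset.inter_comm, Finset.union_comm]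
    exact h.2 B hB A hA⟩⟩
  loopless := ⟨fun _ h => h.1 rfl⟩

/-- The full automorphism group of a graph, with composition as multiplication. -/
abbrev GraphAut {V : Type*} (Γ : SimpleGraph V) : Type _ := Γ ≃g Γ

/-- The set of all flags of type `T` that have `A` as a member. -/
def flagsThrough (n : ℕ) (T : Finset ℕ) (A : Finset (Fin n)) : Set (FlagOfType n T) :=
  {f | A ∈ f.1}

/-- `S` is a system of nontrivial blocks of the group `G` acting on `X`: the action is transitive,
and `S` is the set of all translates of some non-empty block which is neither a singleton nor the
whole of `X`. -/
def IsNontrivialBlockSystem (G : Type*) {X : Type*} [Group G] [MulAction G X]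
    (S : Set (Set X)) : Prop :=
  MulAction.IsPretransitive G X ∧
    ∃ Δ : Set X, Δ.Nonempty ∧ MulAction.IsBlock G Δ ∧ ¬ MulAction.IsTrivialBlock Δ ∧
      S = {Y : Set X | ∃ g : G, Y = g • Δ}

namespace FlagOfType

section Member

variable {n : ℕ} {T : Finset ℕ}

theorem exists_mem_card (f : FlagOfType n T) {t : ℕ} (ht : t ∈ T) : ∃ X ∈ f.1, X.card = t := by
  have h := f.2.2
  rw [← h] at ht
  simpa [flagType] using ht

/-- The member of the flag `f` with `t` elements. -/
noncomputable def member (f : FlagOfType n T) {t : ℕ} (ht : t ∈ T) : Finset (Fin n) :=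
  (f.exists_mem_card ht).choose

theorem member_mem (f : FlagOfType n T) {t : ℕ} (ht : t ∈ T) : f.member ht ∈ f.1 :=
  (f.exists_mem_card ht).choose_spec.1

theorem card_member (f : FlagOfType n T) {t : ℕ} (ht : t ∈ T) : (f.member ht).card = t :=
  (f.exists_mem_card ht).choose_spec.2

theorem eq_member (f : FlagOfType n T) {t : ℕ} (ht : t ∈ T) {X : Finset (Fin n)}
    (hX : X ∈ f.1) (hc : X.card = t) : X = f.member ht := by
  rcases f.2.1.2 X hX _ (f.member_mem ht) with h | h
  · exact Finset.eq_of_subset_of_card_le h (by rw [hc, card_member])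
  · exact (Finset.eq_of_subset_of_card_le h (by rw [hc, card_member])).symm

end Member

variable {m a : ℕ}

/-- The member of size `a`. -/
noncomputable def small (f : FlagOfType (3 * m) {a, 2 * m}) : Finset (Fin (3 * m)) :=
  f.member (t := a) (by simp)

/-- The complement of the member of size `2 * m`. -/
noncomputable def coLarge (f : FlagOfType (3 * m) {a, 2 * m}) : Finset (Fin (3 * m)) :=
  (f.member (t := 2 * m) (by simp))ᶜ

theorem card_small (f : FlagOfType (3 * m) {a, 2 * m}) : f.small.card = a := f.card_member _

theorem card_coLarge (f : FlagOfType (3 * m) {a, 2 * m}) : f.coLarge.card = m := by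
  rw [coLarge, Finset.card_compl, card_member, Fintype.card_fin]
  omega

theorem mem_iff (f : FlagOfType (3 * m) {a, 2 * m}) {X : Finset (Fin (3 * m))} :
    X ∈ f.1 ↔ X = f.small ∨ X = f.coLargeᶜ := by
  constructor
  · intro hX
    have h : X.card ∈ ({a, 2 * m} : Finset ℕ) := by
      rw [← f.2.2]
      exact Finset.mem_image_of_mem _ hX
    rcases Finset.mem_insert.1 h with h | h
    · exact Or.inl (f.eq_member _ hX h)
    · right
      rw [coLarge, compl_compl]
      exact f.eq_member _ hX (Finset.mem_singleton.1 h)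
  · rintro (rfl | rfl)
    · exact f.member_mem _
    · rw [coLarge, compl_compl]
      exact f.member_mem _

theorem disjoint_small_coLarge (ham : a < m) (f : FlagOfType (3 * m) {a, 2 * m}) :
    Disjoint f.small f.coLarge := by
  rw [coLarge, disjoint_compl_right_iff]
  rcases f.2.1.2 _ (f.member_mem (t := a) (by simp)) _
    (f.member_mem (t := 2 * m) (by simp)) with h | h
  · exact h
  · have := Finset.card_le_card h
    rw [card_member, card_member] at this
    omega

theorem ext' {f g : FlagOfType (3 * m) {a, 2 * m}} (h₁ : f.small = g.small)
    (h₂ : f.coLarge = g.coLarge) : f = g := by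
  apply Subtype.ext
  ext X
  rw [mem_iff, mem_iff, h₁, h₂]

theorem exists_small_coLarge (ha : 1 ≤ a) (ham : a < m) {A C : Finset (Fin (3 * m))}
    (hA : A.card = a) (hC : C.card = m) (hAC : Disjoint A C) :
    ∃ f : FlagOfType (3 * m) {a, 2 * m}, f.small = A ∧ f.coLarge = C := by
  have hB : Cᶜ.card = 2 * m := by rw [Finset.card_compl, hC, Fintype.card_fin]; omega
  have hAB : A ⊆ Cᶜ := Finset.subset_compl_iff_disjoint_right.2 hAC
  have ne_univ : ∀ X : Finset (Fin (3 * m)), X.card < 3 * m → X ≠ Finset.univ := by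
    rintro X hX rfl
    simp at hX
  let f : FlagOfType (3 * m) {a, 2 * m} := ⟨{A, Cᶜ}, ⟨by
    intro X hX
    rcases Finset.mem_insert.1 hX with rfl | hX
    · exact ⟨Finset.card_pos.1 (by omega), ne_univ _ (by omega)⟩
    · rw [Finset.mem_singleton.1 hX]
      exact ⟨Finset.card_pos.1 (by omega), ne_univ _ (by omega)⟩, by
    intro X hX Y hY
    rw [Finset.mem_insert, Finset.mem_singleton] at hX hY
    rcases hX with rfl | rfl <;> rcases hY with rfl | rfl
    · exact Or.inl subset_rfl
    · exact Or.inl hAB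
    · exact Or.inr hAB
    · exact Or.inl subset_rfl⟩, by
    rw [flagType, Finset.image_insert, Finset.image_singleton, hA, hB]⟩
  refine ⟨f, (f.eq_member _ (by simp [f]) hA).symm, ?_⟩
  rw [coLarge, ← f.eq_member (t := 2 * m) _ (X := Cᶜ) (by simp [f]) hB, compl_compl]

theorem adj_iff (ha : 1 ≤ a) (ham : a < m) {f g : FlagOfType (3 * m) {a, 2 * m}} :
    (generalPositionGraph (3 * m) {a, 2 * m}).Adj f g ↔
      Disjoint f.coLarge g.coLarge ∧ f.small ⊆ g.coLarge ∧ g.small ⊆ f.coLarge := by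
  have not_cover : ∀ X Y : Finset (Fin (3 * m)), X.card + Y.card < 3 * m →
      X ∪ Y ≠ Finset.univ := by
    intro X Y h h'
    have := Finset.card_union_le X Y
    rw [h', Finset.card_univ, Fintype.card_fin] at this
    omega
  have cB : ∀ h : FlagOfType (3 * m) {a, 2 * m}, h.coLargeᶜ.card = 2 * m := by
    intro h
    rw [Finset.card_compl, card_coLarge, Fintype.card_fin]; omega
  constructor
  · rintro ⟨-, h⟩
    refine ⟨?_, ?_, ?_⟩
    · rcases h _ (f.mem_iff.2 (Or.inr rfl)) _ (g.mem_iff.2 (Or.inr rfl)) with h | h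
      · have := Finset.card_union_of_disjoint (Finset.disjoint_iff_inter_eq_empty.2 h)
        have h' := Finset.card_le_univ (f.coLargeᶜ ∪ g.coLargeᶜ)
        rw [this, cB, cB, Fintype.card_fin] at h'
        omega
      · rw [← Finset.compl_inter, Finset.compl_eq_univ_iff] at h
        exact Finset.disjoint_iff_inter_eq_empty.2 h
    · rcases h _ (f.mem_iff.2 (Or.inl rfl)) _ (g.mem_iff.2 (Or.inr rfl)) with h | h
      · rwa [← Finset.disjoint_iff_inter_eq_empty, disjoint_compl_right_iff] at h
      · exact absurd h (not_cover _ _ (by rw [card_small, cB]; omega))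
    · rcases h _ (f.mem_iff.2 (Or.inr rfl)) _ (g.mem_iff.2 (Or.inl rfl)) with h | h
      · rwa [← Finset.disjoint_iff_inter_eq_empty, disjoint_compl_left_iff] at h
      · exact absurd h (not_cover _ _ (by rw [card_small, cB]; omega))
  · rintro ⟨h₁, h₂, h₃⟩
    refine ⟨?_, ?_⟩
    · rintro rfl
      rw [disjoint_self, Finset.bot_eq_empty] at h₁
      have := f.card_coLarge
      rw [h₁, Finset.card_empty] at this
      omega
    · intro X hX Y hY
      rcases f.mem_iff.1 hX with rfl | rfl <;> rcases g.mem_iff.1 hY with rfl | rfl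
      · left
        rw [← Finset.disjoint_iff_inter_eq_empty]
        exact (h₁.symm.mono_left h₂).mono_right h₃
      · left
        rwa [← Finset.disjoint_iff_inter_eq_empty, disjoint_compl_right_iff]
      · left
        rwa [← Finset.disjoint_iff_inter_eq_empty, disjoint_compl_left_iff]
      · right
        rw [← Finset.compl_inter, Finset.compl_eq_univ_iff]
        exact Finset.disjoint_iff_inter_eq_empty.1 h₁

end FlagOfType

namespace Finset

variable {ι : Type*} [DecidableEq ι]

theorem card_sdiff_eq_one_comm {X Y : Finset ι} (h : X.card = Y.card) :
    (X \ Y).card = 1 ↔ (Y \ X).card = 1 := by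
  rw [card_sdiff_comm h]

theorem card_union_of_card_sdiff_eq_one {X Y : Finset ι}
    (h : (X \ Y).card = 1) : (X ∪ Y).card = Y.card + 1 := by
  rw [union_comm, ← union_sdiff_self_eq_union,
    card_union_of_disjoint disjoint_sdiff, h]

theorem exists_insert_of_card_sdiff_eq_one {X Y : Finset ι} (h : X.card = Y.card)
    (hd : (X \ Y).card = 1) :
    ∃ x y, ∃ W : Finset ι, x ∉ W ∧ y ∉ W ∧ x ≠ y ∧ X = insert x W ∧ Y = insert y W := by
  obtain ⟨x, hx⟩ := card_eq_one.1 hd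
  obtain ⟨y, hy⟩ := card_eq_one.1 ((card_sdiff_eq_one_comm h).1 hd)
  have hx' : ∀ z, z ∈ X ∧ z ∉ Y ↔ z = x := fun z => by rw [← mem_sdiff, hx, mem_singleton]
  have hy' : ∀ z, z ∈ Y ∧ z ∉ X ↔ z = y := fun z => by rw [← mem_sdiff, hy, mem_singleton]
  have h1 := (hx' x).2 rfl
  have h2 := (hy' y).2 rfl
  refine ⟨x, y, X ∩ Y, by simp [h1], by simp [h2], ?_, ?_, ?_⟩
  · rintro rfl
    exact h1.2 h2.1
  · ext z
    have := hx' z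
    simp only [mem_insert, mem_inter]
    tauto
  · ext z
    have := hy' z
    simp only [mem_insert, mem_inter]
    tauto

/-- A function on the `k`-subsets of `E` that is constant along the edges of the Johnson graph
is constant. -/
theorem eq_of_eq_of_card_sdiff_eq_one {β : Type*} {E : Finset ι} {k : ℕ} {g : Finset ι → β}
    (hg : ∀ X Y, X ⊆ E → Y ⊆ E → X.card = k → Y.card = k → (X \ Y).card = 1 → g X = g Y)
    {X Y : Finset ι} (hXE : X ⊆ E) (hYE : Y ⊆ E) (hX : X.card = k) (hY : Y.card = k) :
    g X = g Y := by
  induction hd : (X \ Y).card generalizing X with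
  | zero =>
    rw [card_eq_zero, sdiff_eq_empty_iff_subset] at hd
    rw [eq_of_subset_of_card_le hd (by omega)]
  | succ d ih =>
    have hd' : (Y \ X).card = d + 1 := by rw [← card_sdiff_comm (hX.trans hY.symm), hd]
    obtain ⟨x, hx⟩ := card_pos.1 (by omega : 0 < (X \ Y).card)
    obtain ⟨y, hy⟩ := card_pos.1 (by omega : 0 < (Y \ X).card)
    rw [mem_sdiff] at hx hy
    have hxy : x ≠ y := by
      rintro rfl
      exact hx.2 hy.1
    have hyX : y ∉ X.erase x := fun h => hy.2 (mem_of_mem_erase h)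
    have hZ : (insert y (X.erase x)).card = k := by
      rw [card_insert_of_notMem hyX, card_erase_of_mem hx.1, hX]
      have := card_pos.2 ⟨x, hx.1⟩
      omega
    have hZE : insert y (X.erase x) ⊆ E :=
      insert_subset (hYE hy.1) ((erase_subset _ _).trans hXE)
    have h1 : X \ insert y (X.erase x) = {x} := by
      ext z
      simp only [mem_sdiff, mem_insert, mem_erase, mem_singleton]
      constructor
      · rintro ⟨h, h'⟩
        by_contra h''
        exact h' (Or.inr ⟨h'', h⟩)
      · rintro rfl
        exact ⟨hx.1, by tauto⟩
    have h2 : insert y (X.erase x) \ Y = (X \ Y).erase x := by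
      ext z
      simp only [mem_sdiff, mem_insert, mem_erase]
      constructor
      · rintro ⟨rfl | h, h'⟩
        · exact absurd hy.1 h'
        · exact ⟨h.1, h.2, h'⟩
      · rintro ⟨h, h', h''⟩
        exact ⟨Or.inr ⟨h, h'⟩, h''⟩
    rw [hg X _ hXE hZE hX hZ (by rw [h1, card_singleton])]
    apply ih hZE hZ
    rw [h2, card_erase_of_mem (mem_sdiff.2 hx), hd]
    rfl

/-- Adjacent vertices of the Johnson graph of `k`-subsets of `E` have `#E - 2` common
neighbours. -/
theorem card_filter_card_sdiff_eq_one {E X Y : Finset ι} {k : ℕ} (hXE : X ⊆ E) (hYE : Y ⊆ E)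
    (hX : X.card = k) (hY : Y.card = k) (hd : (X \ Y).card = 1) :
    ((E.powersetCard k).filter fun Z => (X \ Z).card = 1 ∧ (Y \ Z).card = 1).card =
      E.card - 2 := by
  obtain ⟨x, y, W, hxW, hyW, hxy, rfl, rfl⟩ :=
    exists_insert_of_card_sdiff_eq_one (hX.trans hY.symm) hd
  have hk : W.card + 1 = k := by rw [← hX, card_insert_of_notMem hxW]
  have hWE : W ⊆ E := (subset_insert _ _).trans hXE
  have hxE : x ∈ E := hXE (mem_insert_self _ _)
  have hyE : y ∈ E := hYE (mem_insert_self _ _)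
  have hE : ((E.erase x).erase y).card = E.card - 2 := by
    rw [card_erase_of_mem (mem_erase.2 ⟨hxy.symm, hyE⟩), card_erase_of_mem hxE]
    omega
  rw [← hE]
  symm
  have hcard : ∀ z ∈ W, (insert x (insert y (W.erase z))).card = k := by
    intro z hz
    rw [card_insert_of_notMem (by simp [hxy, hxW]), card_insert_of_notMem (by simp [hyW]),
      card_erase_of_mem hz]
    have := card_pos.2 ⟨z, hz⟩
    omega
  refine card_bij (fun z _ => if z ∈ W then insert x (insert y (W.erase z)) else insert z W)
    ?_ ?_ ?_
  · intro z hz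
    simp only [mem_erase] at hz
    obtain ⟨hzy, hzx, hzE⟩ := hz
    rw [mem_filter, mem_powersetCard]
    split_ifs with h
    · refine ⟨⟨?_, hcard z h⟩, card_eq_one.2 ⟨z, ?_⟩, card_eq_one.2 ⟨z, ?_⟩⟩
      · exact insert_subset hxE (insert_subset hyE ((erase_subset _ _).trans hWE))
      · ext w
        simp only [mem_sdiff, mem_insert, mem_erase, mem_singleton]
        constructor
        · tauto
        · rintro rfl; tauto
      · ext w
        simp only [mem_sdiff, mem_insert, mem_erase, mem_singleton]
        constructor
        · tauto
        · rintro rfl; tauto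
    · refine ⟨⟨insert_subset hzE hWE, ?_⟩, card_eq_one.2 ⟨x, ?_⟩, card_eq_one.2 ⟨y, ?_⟩⟩
      · rw [card_insert_of_notMem h, hk]
      · ext w
        simp only [mem_sdiff, mem_insert, mem_singleton]
        constructor
        · tauto
        · rintro rfl; tauto
      · ext w
        simp only [mem_sdiff, mem_insert, mem_singleton]
        constructor
        · tauto
        · rintro rfl; tauto
  · intro z hz w hw h
    simp only [mem_erase] at hz hw
    have e : ∀ t, t ∈ (if z ∈ W then insert x (insert y (W.erase z)) else insert z W) ↔
      t ∈ (if w ∈ W then insert x (insert y (W.erase w)) else insert w W) := fun t => by rw [h]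
    have ez := e z
    have ew := e w
    have ex := e x
    split_ifs at ez ew ex <;> simp only [mem_insert, mem_erase] at ez ew ex <;> grind
  · intro Z hZ
    rw [mem_filter, mem_powersetCard] at hZ
    obtain ⟨⟨hZE, hZk⟩, h1, h2⟩ := hZ
    obtain ⟨u, hu⟩ := card_eq_one.1 h1
    obtain ⟨v, hv⟩ := card_eq_one.1 h2
    have hu' : ∀ t, t ∈ insert x W ∧ t ∉ Z ↔ t = u := fun t => by
      rw [← mem_sdiff, hu, mem_singleton]
    have hv' : ∀ t, t ∈ insert y W ∧ t ∉ Z ↔ t = v := fun t => by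
      rw [← mem_sdiff, hv, mem_singleton]
    simp only [mem_insert] at hu' hv'
    by_cases hxZ : x ∈ Z
    · have huW : u ∈ W := by
        have := (hu' u).2 rfl
        grind
      have huZ : u ∉ Z := ((hu' u).2 rfl).2
      have huv : u = v := (hv' u).1 ⟨Or.inr huW, huZ⟩
      have hyZ : y ∈ Z := by
        by_contra hyZ
        exact hyW ((hv' y).1 ⟨Or.inl rfl, hyZ⟩ ▸ huv ▸ huW)
      refine ⟨u, ?_, ?_⟩
      · simp only [mem_erase]
        refine ⟨?_, ?_, hWE huW⟩ <;> rintro rfl <;> contradiction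
      · rw [if_pos huW]
        refine eq_of_subset_of_card_le ?_ (by rw [hcard u huW, hZk])
        intro t ht
        have := hu' t
        simp only [mem_insert, mem_erase] at ht
        grind
    · have hux : x = u := (hu' x).1 ⟨Or.inl rfl, hxZ⟩
      have hWZ : W ⊆ Z := by
        intro t ht
        by_contra htZ
        exact hxW (hux.trans ((hu' t).1 ⟨Or.inr ht, htZ⟩).symm ▸ ht)
      have hyZ : y ∉ Z := by
        have := (hv' v).2 rfl
        grind
      obtain ⟨z, hz⟩ := card_eq_one.1 (show (Z \ W).card = 1 by
        rw [card_sdiff_of_subset hWZ]; omega)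
      have hz' : z ∈ Z ∧ z ∉ W := by rw [← mem_sdiff, hz, mem_singleton]
      refine ⟨z, ?_, ?_⟩
      · simp only [mem_erase]
        refine ⟨?_, ?_, hZE hz'.1⟩ <;> rintro rfl
        · exact hyZ hz'.1
        · exact hxZ hz'.1
      · rw [if_neg hz'.2]
        exact eq_of_subset_of_card_le (insert_subset hz'.1 hWZ)
          (by rw [card_insert_of_notMem hz'.2, hk, hZk])

end Finset

namespace Finset

variable {ι : Type*} [DecidableEq ι]

/-- The union of the images under `σ` of the `a`-subsets of `U`. -/
def spread (σ : Finset ι → Finset ι) (a : ℕ) (U : Finset ι) : Finset ι :=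
  (U.powersetCard a).biUnion σ

variable {σ : Finset ι → Finset ι} {a : ℕ}

theorem subset_spread {A U : Finset ι} (hA : A.card = a) (hAU : A ⊆ U) : σ A ⊆ spread σ a U :=
  subset_biUnion_of_mem σ (mem_powersetCard.2 ⟨hAU, hA⟩)

theorem spread_mono {U V : Finset ι} (h : U ⊆ V) : spread σ a U ⊆ spread σ a V :=
  biUnion_subset_biUnion_of_subset_left _ (powersetCard_mono h)

variable {τ τ' : Finset ι → Finset ι} {m : ℕ}

theorem disjoint_spread_iff (ha : 1 ≤ a)
    (hd : ∀ A C, A.card = a → C.card = m → (Disjoint A C ↔ Disjoint (σ A) (τ C)))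
    {U C : Finset ι} (hU : a ≤ U.card) (hC : C.card = m) :
    Disjoint U C ↔ Disjoint (spread σ a U) (τ C) := by
  rw [spread, disjoint_biUnion_left]
  constructor
  · intro h A hA
    rw [mem_powersetCard] at hA
    exact (hd A C hA.2 hC).1 (h.mono_left hA.1)
  · intro h
    rw [disjoint_left]
    intro x hx
    obtain ⟨A, h1, h2, h3⟩ := exists_subsuperset_card_eq (s := {x}) (t := U) (n := a)
      (by simpa using hx) (by simpa using ha) hU
    exact disjoint_left.1 ((hd A C h3 hC).2 (h A (mem_powersetCard.2 ⟨h2, h3⟩)))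
      (h1 (mem_singleton_self _))

variable [Fintype ι]

theorem card_filter_disjoint_powersetCard (k : ℕ) (U : Finset ι) :
    ((powersetCard k univ).filter fun C => Disjoint U C).card =
      (Fintype.card ι - U.card).choose k := by
  rw [← card_compl, ← card_powersetCard]
  congr 1
  ext C
  simp only [mem_filter, mem_powersetCard, subset_univ, true_and]
  rw [subset_compl_iff_disjoint_left, and_comm]

theorem exists_card_eq_mem_disjoint {k : ℕ} {U : Finset ι} {x : ι} (hk : 1 ≤ k) (hx : x ∉ U)
    (hU : U.card + k ≤ Fintype.card ι) : ∃ C : Finset ι, C.card = k ∧ x ∈ C ∧ Disjoint U C := by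
  obtain ⟨C, h1, h2, h3⟩ := exists_subsuperset_card_eq (s := {x}) (t := Uᶜ) (n := k)
    (by simpa using hx) (by simpa using hk) (by rw [card_compl]; omega)
  exact ⟨C, h3, h1 (mem_singleton_self _), subset_compl_iff_disjoint_left.1 h2⟩

theorem eq_of_choose_eq_choose {p q k : ℕ} (hk : 1 ≤ k) (hp : k ≤ p)
    (h : p.choose k = q.choose k) : p = q := by
  have mono : ∀ {r s : ℕ}, k ≤ s → r < s → r.choose k < s.choose k := by
    intro r s hs hrs
    obtain ⟨s, rfl⟩ : ∃ t, s = t + 1 := ⟨s - 1, by omega⟩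
    obtain ⟨k, rfl⟩ : ∃ t, k = t + 1 := ⟨k - 1, by omega⟩
    have h1 : r.choose (k + 1) ≤ s.choose (k + 1) := Nat.choose_le_choose _ (by omega)
    have h2 : 0 < s.choose k := Nat.choose_pos (by omega)
    rw [Nat.choose_succ_succ, Nat.succ_eq_add_one]
    omega
  rcases lt_trichotomy p q with h' | h' | h'
  · exact absurd h (mono (hp.trans h'.le) h').ne
  · exact h'
  · exact absurd h (mono hp h').ne'

theorem card_spread (ha : 1 ≤ a) (hm : 1 ≤ m)
    (hτ : ∀ C, C.card = m → (τ C).card = m) (hτ' : ∀ C, C.card = m → (τ' C).card = m)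
    (hττ' : ∀ C, C.card = m → τ (τ' C) = C) (hτ'τ : ∀ C, C.card = m → τ' (τ C) = C)
    (hd : ∀ A C, A.card = a → C.card = m → (Disjoint A C ↔ Disjoint (σ A) (τ C)))
    {U : Finset ι} (hU : a ≤ U.card) (hUm : U.card + m ≤ Fintype.card ι) :
    (spread σ a U).card = U.card := by
  have key : ((powersetCard m univ).filter fun C => Disjoint U C).card =
      ((powersetCard m univ).filter fun C => Disjoint (spread σ a U) C).card := by
    refine card_bij' (fun C _ => τ C) (fun C _ => τ' C) ?_ ?_ ?_ ?_ <;> intro C hC <;>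
      rw [mem_filter, mem_powersetCard] at hC <;> obtain ⟨⟨-, hC⟩, hC'⟩ := hC
    · rw [mem_filter, mem_powersetCard]
      exact ⟨⟨subset_univ _, hτ C hC⟩, (disjoint_spread_iff ha hd hU hC).1 hC'⟩
    · rw [mem_filter, mem_powersetCard]
      refine ⟨⟨subset_univ _, hτ' C hC⟩, (disjoint_spread_iff ha hd hU (hτ' C hC)).2 ?_⟩
      rwa [hττ' C hC]
    · exact hτ'τ C hC
    · exact hττ' C hC
  rw [card_filter_disjoint_powersetCard, card_filter_disjoint_powersetCard] at key
  have := eq_of_choose_eq_choose hm (by omega) key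
  have := card_le_univ (spread σ a U)
  omega

/-- The point to which a disjointness-preserving pair of maps on `a`-sets and `m`-sets
moves `x`. -/
theorem exists_forall_notMem (ha : 1 ≤ a) (hm : 1 ≤ m) (ham : a + 2 + m ≤ Fintype.card ι)
    (hσ : ∀ A, A.card = a → (σ A).card = a)
    (hτ : ∀ C, C.card = m → (τ C).card = m) (hτ' : ∀ C, C.card = m → (τ' C).card = m)
    (hττ' : ∀ C, C.card = m → τ (τ' C) = C) (hτ'τ : ∀ C, C.card = m → τ' (τ C) = C)
    (hd : ∀ A C, A.card = a → C.card = m → (Disjoint A C ↔ Disjoint (σ A) (τ C))) (x : ι) :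
    ∃ y, ∀ A, A.card = a → x ∉ A → y ∉ σ A := by
  have cs : ∀ {U : Finset ι}, a ≤ U.card → U.card ≤ a + 2 → (spread σ a U).card = U.card :=
    fun h h' => card_spread ha hm hτ hτ' hττ' hτ'τ hd h (by omega)
  have cW : ∀ W : Finset ι, W.card = a → x ∉ W →
      (spread σ a (insert x W) \ σ W).card = 1 := by
    intro W hW hx
    have h1 : (insert x W).card = a + 1 := by rw [card_insert_of_notMem hx, hW]
    rw [card_sdiff_of_subset (subset_spread hW (subset_insert _ _)), cs (by omega) (by omega),
      h1, hσ W hW]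
    omega
  have step : ∀ W U : Finset ι, W.card = a → U.card = a + 1 → W ⊆ U → x ∉ U →
      spread σ a (insert x W) \ σ W = spread σ a (insert x U) \ spread σ a U := by
    intro W U hW hU hWU hx
    have hxW : x ∉ W := fun h => hx (hWU h)
    have hxU : (insert x U).card = a + 2 := by rw [card_insert_of_notMem hx, hU]
    refine eq_of_subset_of_card_le ?_ ?_
    · intro y hy
      rw [mem_sdiff]
      refine ⟨spread_mono (insert_subset_insert _ hWU) (mem_sdiff.1 hy).1, fun hyU => ?_⟩
      have hsub : spread σ a (insert x W) ⊆ spread σ a U := by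
        intro z hz
        by_cases hzW : z ∈ σ W
        · exact subset_spread hW hWU hzW
        · rwa [card_le_one.1 (cW W hW hxW).le z (mem_sdiff.2 ⟨hz, hzW⟩) y hy]
      obtain ⟨C, hC, hxC, hUC⟩ := exists_card_eq_mem_disjoint (k := m) hm hx (by omega)
      have h1 := (disjoint_spread_iff ha hd (by omega) hC).1 hUC
      have h2 := (disjoint_spread_iff (U := insert x W) ha hd
        (by rw [card_insert_of_notMem hxW]; omega) hC).2 (h1.mono_left hsub)
      exact disjoint_left.1 h2 (mem_insert_self _ _) hxC
    · rw [cW W hW hxW, card_sdiff_of_subset (spread_mono (subset_insert _ _)),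
        cs (by omega) (by omega), cs (by omega) (by omega)]
      omega
  obtain ⟨W, hWx, hW⟩ := exists_subset_card_eq (s := univ.erase x) (n := a)
    (by rw [card_erase_of_mem (mem_univ _), card_univ]; omega)
  have sub_iff : ∀ {V : Finset ι}, V ⊆ univ.erase x → x ∉ V := fun h h' =>
    notMem_erase x _ (h h')
  obtain ⟨y, hy⟩ := card_eq_one.1 (cW W hW (sub_iff hWx))
  refine ⟨y, fun A hA hxA => ?_⟩
  have h : spread σ a (insert x A) \ σ A = spread σ a (insert x W) \ σ W := by
    refine eq_of_eq_of_card_sdiff_eq_one (E := univ.erase x) (k := a)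
      (g := fun W => spread σ a (insert x W) \ σ W) ?_ ?_ hWx hA hW
    · intro X Y hXE hYE hX hY hXY
      have hU : (X ∪ Y).card = a + 1 := by
        rw [union_comm, ← union_sdiff_self_eq_union, card_union_of_disjoint disjoint_sdiff, hXY,
          hY]
      have hxU : x ∉ X ∪ Y := by
        rw [mem_union, not_or]
        exact ⟨sub_iff hXE, sub_iff hYE⟩
      exact (step X _ hX hU subset_union_left hxU).trans
        (step Y _ hY hU subset_union_right hxU).symm
    · intro z hz
      rw [mem_erase]
      exact ⟨fun e => hxA (e ▸ hz), mem_univ _⟩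
  have : y ∈ spread σ a (insert x A) \ σ A := by rw [h, hy, mem_singleton]
  exact (mem_sdiff.1 this).2

/-- A pair of permutations of the `a`-sets and of the `m`-sets that preserves disjointness is
induced by a permutation of the points. -/
theorem exists_perm_of_disjoint_iff {σ σ' τ τ' : Finset ι → Finset ι} {a m : ℕ}
    (ha : 1 ≤ a) (hm : 1 ≤ m) (ham : a + 2 + m ≤ Fintype.card ι)
    (hσ : ∀ A, A.card = a → (σ A).card = a) (hσ' : ∀ A, A.card = a → (σ' A).card = a)
    (hσσ' : ∀ A, A.card = a → σ (σ' A) = A) (hσ'σ : ∀ A, A.card = a → σ' (σ A) = A)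
    (hτ : ∀ C, C.card = m → (τ C).card = m) (hτ' : ∀ C, C.card = m → (τ' C).card = m)
    (hττ' : ∀ C, C.card = m → τ (τ' C) = C) (hτ'τ : ∀ C, C.card = m → τ' (τ C) = C)
    (hd : ∀ A C, A.card = a → C.card = m → (Disjoint A C ↔ Disjoint (σ A) (τ C))) :
    ∃ π : Equiv.Perm ι, (∀ A, A.card = a → σ A = π • A) ∧ ∀ C, C.card = m → τ C = π • C := by
  have hd' : ∀ A C, A.card = a → C.card = m → (Disjoint A C ↔ Disjoint (σ' A) (τ' C)) := by
    intro A C hA hC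
    rw [hd _ _ (hσ' A hA) (hτ' C hC), hσσ' A hA, hττ' C hC]
  choose f hf using exists_forall_notMem ha hm ham hσ hτ hτ' hττ' hτ'τ hd
  choose g hg using exists_forall_notMem ha hm ham hσ' hτ' hτ hτ'τ hττ' hd'
  have inv : ∀ x y : ι, (∀ A : Finset ι, A.card = a → x ∉ A → y ∉ A) → y = x := by
    intro x y h
    by_contra hxy
    obtain ⟨A, hA, hyA, hxA⟩ := exists_card_eq_mem_disjoint (k := a) (U := {x}) (x := y) ha
      (by simpa using hxy) (by rw [card_singleton]; omega)
    exact h A hA (disjoint_left.1 hxA (mem_singleton_self _)) hyA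
  have gf : ∀ x, g (f x) = x := fun x => inv _ _ fun A hA hx => by
    have := hg (f x) (σ A) (hσ A hA) (hf x A hA hx)
    rwa [hσ'σ A hA] at this
  have fg : ∀ x, f (g x) = x := fun x => inv _ _ fun A hA hx => by
    have := hf (g x) (σ' A) (hσ' A hA) (hg x A hA hx)
    rwa [hσσ' A hA] at this
  let π : Equiv.Perm ι := ⟨f, g, gf, fg⟩
  have hπσ : ∀ A, A.card = a → σ A = π • A := by
    intro A hA
    refine eq_of_subset_of_card_le ?_ (by rw [card_smul_finset, hσ A hA, hA])
    intro y hy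
    rw [mem_smul_finset]
    refine ⟨g y, ?_, fg y⟩
    by_contra h
    exact hf (g y) A hA h (by rwa [fg])
  refine ⟨π, hπσ, fun C hC => ?_⟩
  refine eq_of_subset_of_card_le ?_ (by rw [card_smul_finset, hτ C hC, hC])
  intro y hy
  rw [mem_smul_finset]
  refine ⟨g y, ?_, fg y⟩
  by_contra h
  obtain ⟨A, hA, hyA, hCA⟩ := exists_card_eq_mem_disjoint (k := a) ha h (by omega)
  have := (hd A C hA hC).1 hCA.symm
  rw [hπσ A hA] at this
  exact disjoint_left.1 this (mem_smul_finset.2 ⟨g y, hyA, fg y⟩) hy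

end Finset

namespace SimpleGraph

variable {V : Type*}

/-- Distinct vertices `u` and `v` whose set of common neighbours is non-empty and maximal, under
inclusion, among the sets of common neighbours of `u` and another vertex. -/
def MaximallyClose (Γ : SimpleGraph V) (u v : V) : Prop :=
  u ≠ v ∧ (∃ w, Γ.Adj u w ∧ Γ.Adj v w) ∧
    ∀ x, x ≠ u → (∀ w, Γ.Adj u w → Γ.Adj v w → Γ.Adj x w) →
      ∀ w, Γ.Adj u w → Γ.Adj x w → Γ.Adj v w

theorem MaximallyClose.apply {Γ : SimpleGraph V} (α : Γ ≃g Γ) {u v : V}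
    (h : Γ.MaximallyClose u v) : Γ.MaximallyClose (α u) (α v) := by
  obtain ⟨hne, ⟨w, huw, hvw⟩, hmax⟩ := h
  refine ⟨α.injective.ne hne, ⟨α w, α.map_adj_iff.2 huw, α.map_adj_iff.2 hvw⟩, ?_⟩
  intro x hx hxw w huw hvw
  obtain ⟨x, rfl⟩ := α.surjective x
  obtain ⟨w, rfl⟩ := α.surjective w
  rw [α.map_adj_iff] at huw hvw ⊢
  refine hmax x (fun h => hx (h ▸ rfl)) (fun y huy hvy => ?_) w huw hvw
  exact α.map_adj_iff.1 (hxw (α y) (α.map_adj_iff.2 huy) (α.map_adj_iff.2 hvy))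

theorem maximallyClose_apply_iff {Γ : SimpleGraph V} (α : Γ ≃g Γ) {u v : V} :
    Γ.MaximallyClose (α u) (α v) ↔ Γ.MaximallyClose u v := by
  refine ⟨fun h => ?_, fun h => h.apply α⟩
  have := h.apply α.symm
  rwa [RelIso.symm_apply_apply, RelIso.symm_apply_apply] at this

theorem ncard_maximallyClose_apply {Γ : SimpleGraph V} (α : Γ ≃g Γ) (u v : V) :
    {x | Γ.MaximallyClose (α u) x ∧ Γ.MaximallyClose (α v) x}.ncard =
      {x | Γ.MaximallyClose u x ∧ Γ.MaximallyClose v x}.ncard := by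
  rw [← Set.ncard_image_of_injective {x | Γ.MaximallyClose u x ∧ Γ.MaximallyClose v x}
    α.injective]
  congr 1
  ext x
  obtain ⟨x, rfl⟩ := α.surjective x
  simp [maximallyClose_apply_iff]

end SimpleGraph

namespace FlagOfType

variable {m a : ℕ}

/-- The flags share their small member, and their large members differ by one exchange. -/
def SmallTwin (u v : FlagOfType (3 * m) {a, 2 * m}) : Prop :=
  u.small = v.small ∧ (u.coLarge \ v.coLarge).card = 1

/-- The flags share their large member, and their small members differ by one exchange. -/
def LargeTwin (u v : FlagOfType (3 * m) {a, 2 * m}) : Prop :=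
  u.coLarge = v.coLarge ∧ (u.small \ v.small).card = 1

theorem exists_common_neighbor (ha : 1 ≤ a) (ham : a < m) {u v : FlagOfType (3 * m) {a, 2 * m}}
    {P Q S : Finset (Fin (3 * m))} (hPu : P ⊆ u.coLarge) (hPv : P ⊆ v.coLarge)
    (hP : P.card ≤ a) (huv : a ≤ (u.coLarge ∩ v.coLarge).card)
    (huQ : u.small ⊆ Q) (hvQ : v.small ⊆ Q) (hQ : Q.card ≤ m) (hQS : Q ⊆ S)
    (hSu : Disjoint S u.coLarge) (hSv : Disjoint S v.coLarge) (hS : m ≤ S.card) :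
    ∃ w, (generalPositionGraph (3 * m) {a, 2 * m}).Adj u w ∧
      (generalPositionGraph (3 * m) {a, 2 * m}).Adj v w ∧
      P ⊆ w.small ∧ Q ⊆ w.coLarge ∧ w.coLarge ⊆ S := by
  obtain ⟨A, hPA, hAuv, hA⟩ :=
    Finset.exists_subsuperset_card_eq (Finset.subset_inter hPu hPv) hP huv
  obtain ⟨C, hQC, hCS, hC⟩ := Finset.exists_subsuperset_card_eq hQS hQ hS
  have hAu : A ⊆ u.coLarge := hAuv.trans Finset.inter_subset_left
  have hAv : A ⊆ v.coLarge := hAuv.trans Finset.inter_subset_right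
  obtain ⟨w, rfl, rfl⟩ := exists_small_coLarge ha ham hA hC
    ((hSu.mono_left hCS).symm.mono_left hAu)
  refine ⟨w, (adj_iff ha ham).2 ⟨(hSu.mono_left hCS).symm, huQ.trans hQC, hAu⟩,
    (adj_iff ha ham).2 ⟨(hSv.mono_left hCS).symm, hvQ.trans hQC, hAv⟩, hPA, hQC, hCS⟩

theorem SmallTwin.maximallyClose (ha : 1 ≤ a) (ham : a < m)
    {u v : FlagOfType (3 * m) {a, 2 * m}} (h : SmallTwin u v) :
    (generalPositionGraph (3 * m) {a, 2 * m}).MaximallyClose u v := by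
  obtain ⟨hA, hC⟩ := h
  have cu := u.card_coLarge
  have hcup := Finset.card_union_of_card_sdiff_eq_one hC
  rw [v.card_coLarge] at hcup
  have hcap := Finset.card_union_add_card_inter u.coLarge v.coLarge
  rw [hcup, u.card_coLarge, v.card_coLarge] at hcap
  have hcomp : (u.coLarge ∪ v.coLarge)ᶜ.card = 2 * m - 1 := by
    rw [Finset.card_compl, hcup, Fintype.card_fin]; omega
  have hdu : Disjoint (u.coLarge ∪ v.coLarge)ᶜ u.coLarge :=
    disjoint_compl_left.mono_right Finset.subset_union_left
  have hdv : Disjoint (u.coLarge ∪ v.coLarge)ᶜ v.coLarge :=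
    disjoint_compl_left.mono_right Finset.subset_union_right
  have hsub : u.small ⊆ (u.coLarge ∪ v.coLarge)ᶜ := by
    rw [Finset.subset_compl_iff_disjoint_right, Finset.disjoint_union_right]
    exact ⟨u.disjoint_small_coLarge ham, hA ▸ v.disjoint_small_coLarge ham⟩
  have csmall := u.card_small
  refine ⟨?_, ?_, ?_⟩
  · rintro rfl
    simp at hC
  · obtain ⟨w, h1, h2, -⟩ := exists_common_neighbor ha ham (P := ∅) (Q := u.small)
      (Finset.empty_subset _) (Finset.empty_subset _) (by simp) (by omega) subset_rfl hA.ge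
      (by omega) hsub hdu hdv (by omega)
    exact ⟨w, h1, h2⟩
  · intro x hxu hx
    have hxA : x.small ⊆ u.small := by
      intro y hy
      by_contra hyu
      obtain ⟨w, h1, h2, -, -, h3⟩ := exists_common_neighbor ha ham (P := ∅) (Q := u.small)
        (S := (u.coLarge ∪ v.coLarge)ᶜ.erase y)
        (Finset.empty_subset _) (Finset.empty_subset _) (by simp) (by omega) subset_rfl hA.ge
        (by omega) (Finset.subset_erase.2 ⟨hsub, hyu⟩)
        (hdu.mono_left (Finset.erase_subset _ _))
        (hdv.mono_left (Finset.erase_subset _ _))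
        (by have := Finset.pred_card_le_card_erase (s := (u.coLarge ∪ v.coLarge)ᶜ) (a := y)
            omega)
      exact Finset.notMem_erase y _ (h3 (((adj_iff ha ham).1 (hx w h1 h2)).2.1 hy))
    have hxA : x.small = u.small :=
      Finset.eq_of_subset_of_card_le hxA (by rw [card_small, card_small])
    have hcap_le : u.coLarge ∩ v.coLarge ⊆ x.coLarge := by
      intro z hz
      rw [Finset.mem_inter] at hz
      obtain ⟨w, h1, h2, h3, -⟩ := exists_common_neighbor ha ham (P := {z}) (Q := u.small)
        (by simpa using hz.1) (by simpa using hz.2) (by simpa using ha) (by omega) subset_rfl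
        hA.ge (by omega) hsub hdu hdv (by omega)
      exact ((adj_iff ha ham).1 (hx w h1 h2)).2.2 (h3 (Finset.mem_singleton_self z))
    have hle_cup : x.coLarge ⊆ u.coLarge ∪ v.coLarge := by
      intro y hy
      by_contra hyuv
      obtain ⟨w, h1, h2, -, h3, -⟩ := exists_common_neighbor ha ham (P := ∅)
        (Q := insert y u.small) (Finset.empty_subset _) (Finset.empty_subset _) (by simp)
        (by omega) (Finset.subset_insert _ _) (hA.ge.trans (Finset.subset_insert _ _))
        (by have := Finset.card_insert_le y u.small
            omega)
        (Finset.insert_subset (by simpa using hyuv) hsub) hdu hdv (by omega)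
      exact Finset.disjoint_left.1 ((adj_iff ha ham).1 (hx w h1 h2)).1 hy
        (h3 (Finset.mem_insert_self _ _))
    suffices hxv : x = v by
      rw [hxv]
      exact fun _ _ h => h
    obtain ⟨p, q, W, -, -, -, hp, hq⟩ :=
      Finset.exists_insert_of_card_sdiff_eq_one (cu.trans v.card_coLarge.symm) hC
    refine ext' (hxA.trans hA) ?_
    have hpx : p ∉ x.coLarge := by
      intro hpx
      refine hxu (ext' hxA (Finset.eq_of_subset_of_card_le ?_ ?_).symm)
      · intro z hz
        have hz' := hz
        rw [hp, Finset.mem_insert] at hz'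
        rcases hz' with rfl | hz'
        · exact hpx
        · exact hcap_le (Finset.mem_inter.2 ⟨hz, hq ▸ Finset.mem_insert_of_mem hz'⟩)
      · rw [card_coLarge, card_coLarge]
    refine Finset.eq_of_subset_of_card_le ?_ (by rw [card_coLarge, card_coLarge])
    intro z hz
    have := hle_cup hz
    rw [hp, hq, Finset.mem_union, Finset.mem_insert, Finset.mem_insert] at this
    rw [hq, Finset.mem_insert]
    rcases this with (rfl | h) | h
    · exact absurd hz hpx
    · exact Or.inr h
    · exact h

theorem LargeTwin.maximallyClose (ha : 1 ≤ a) (ham : a < m)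
    {u v : FlagOfType (3 * m) {a, 2 * m}} (h : LargeTwin u v) :
    (generalPositionGraph (3 * m) {a, 2 * m}).MaximallyClose u v := by
  obtain ⟨hC, hA⟩ := h
  have cu := u.card_coLarge
  have hcup := Finset.card_union_of_card_sdiff_eq_one hA
  rw [v.card_small] at hcup
  have hcap : (u.coLarge ∩ v.coLarge).card = m := by rw [hC, Finset.inter_self, card_coLarge]
  have hcomp : u.coLargeᶜ.card = 2 * m := by
    rw [Finset.card_compl, cu, Fintype.card_fin]; omega
  have hdv : Disjoint u.coLargeᶜ v.coLarge := hC ▸ disjoint_compl_left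
  have hsub : u.small ∪ v.small ⊆ u.coLargeᶜ := by
    rw [Finset.subset_compl_iff_disjoint_right, Finset.disjoint_union_left]
    exact ⟨u.disjoint_small_coLarge ham, hC ▸ v.disjoint_small_coLarge ham⟩
  refine ⟨?_, ?_, ?_⟩
  · rintro rfl
    simp at hA
  · obtain ⟨w, h1, h2, -⟩ := exists_common_neighbor ha ham (P := ∅) (Q := u.small ∪ v.small)
      (Finset.empty_subset _) (Finset.empty_subset _) (by simp) (by omega)
      Finset.subset_union_left Finset.subset_union_right (by omega) hsub
      disjoint_compl_left hdv (by omega)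
    exact ⟨w, h1, h2⟩
  · intro x hxu hx
    have hxC : u.coLarge ⊆ x.coLarge := by
      intro z hz
      obtain ⟨w, h1, h2, h3, -⟩ := exists_common_neighbor ha ham (P := {z})
        (Q := u.small ∪ v.small) (by simpa using hz) (by simpa using hC ▸ hz)
        (by simpa using ha) (by omega) Finset.subset_union_left Finset.subset_union_right
        (by omega) hsub disjoint_compl_left hdv (by omega)
      exact ((adj_iff ha ham).1 (hx w h1 h2)).2.2 (h3 (Finset.mem_singleton_self z))
    have hxC : u.coLarge = x.coLarge :=
      Finset.eq_of_subset_of_card_le hxC (by rw [card_coLarge, card_coLarge])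
    have hxA : x.small ⊆ u.small ∪ v.small := by
      intro y hy
      by_contra hyuv
      obtain ⟨w, h1, h2, -, -, h3⟩ := exists_common_neighbor ha ham (P := ∅)
        (Q := u.small ∪ v.small) (S := u.coLargeᶜ.erase y)
        (Finset.empty_subset _) (Finset.empty_subset _) (by simp) (by omega)
        Finset.subset_union_left Finset.subset_union_right
        (by omega) (Finset.subset_erase.2 ⟨hsub, hyuv⟩)
        (disjoint_compl_left.mono_left (Finset.erase_subset _ _))
        (hdv.mono_left (Finset.erase_subset _ _))
        (by have := Finset.pred_card_le_card_erase (s := u.coLargeᶜ) (a := y)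
            omega)
      exact Finset.notMem_erase y _ (h3 (((adj_iff ha ham).1 (hx w h1 h2)).2.1 hy))
    have hux : u.small ∪ x.small = u.small ∪ v.small := by
      refine Finset.eq_of_subset_of_card_le (Finset.union_subset Finset.subset_union_left hxA) ?_
      have hlt : u.small.card < (u.small ∪ x.small).card := by
        refine Finset.card_lt_card (Finset.ssubset_iff_subset_ne.2
          ⟨Finset.subset_union_left, fun h => hxu (ext' ?_ hxC.symm)⟩)
        exact Finset.eq_of_subset_of_card_le (h ▸ Finset.subset_union_right)
          (by rw [card_small, card_small])
      rw [card_small] at hlt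
      omega
    intro w huw hxw
    rw [adj_iff ha ham] at huw hxw ⊢
    refine ⟨hC ▸ huw.1, ?_, hC ▸ huw.2.2⟩
    exact Finset.subset_union_right.trans (hux.ge.trans (Finset.union_subset huw.2.1 hxw.2.1))

theorem maximallyClose_iff (ha : 1 ≤ a) (ham : a < m) {u v : FlagOfType (3 * m) {a, 2 * m}} :
    (generalPositionGraph (3 * m) {a, 2 * m}).MaximallyClose u v ↔
      SmallTwin u v ∨ LargeTwin u v := by
  refine ⟨?_, fun h => h.elim (SmallTwin.maximallyClose ha ham)
    (LargeTwin.maximallyClose ha ham)⟩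
  rintro ⟨huv, ⟨w₀, hu₀, hv₀⟩, hmax⟩
  rw [adj_iff ha ham] at hu₀ hv₀
  have cA : v.small.card = u.small.card := by rw [card_small, card_small]
  have cC : v.coLarge.card = u.coLarge.card := by rw [card_coLarge, card_coLarge]
  have hdisj : ∀ {X Y}, X ⊆ w₀.coLarge → Disjoint Y w₀.coLarge → Disjoint X Y :=
    fun hX hY => hY.symm.mono_left hX
  have cu := u.card_coLarge
  have csu := u.card_small
  have csv := v.card_small
  have hcap : a ≤ (u.coLarge ∩ v.coLarge).card := by
    have := Finset.card_le_card (Finset.subset_inter hu₀.2.2 hv₀.2.2)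
    rwa [w₀.card_small] at this
  have hcupcap := Finset.card_union_add_card_inter u.coLarge v.coLarge
  have hcupA : (u.small ∪ v.small).card ≤ m := by
    have := Finset.card_le_card (Finset.union_subset hu₀.2.1 hv₀.2.1)
    rwa [w₀.card_coLarge] at this
  by_cases hA : u.small = v.small
  · left
    refine ⟨hA, ?_⟩
    have hne : u.coLarge ≠ v.coLarge := fun h => huv (ext' hA h)
    obtain ⟨p, hp⟩ : (u.coLarge \ v.coLarge).Nonempty := by
      rw [Finset.sdiff_nonempty]
      exact fun h => hne (Finset.eq_of_subset_of_card_le h cC.le)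
    by_contra hcard
    obtain ⟨p', hp', hpp'⟩ : ∃ p' ∈ u.coLarge \ v.coLarge, p' ≠ p := by
      refine Finset.exists_mem_ne ?_ p
      have := Finset.card_pos.2 ⟨p, hp⟩
      omega
    obtain ⟨q, hq⟩ : (v.coLarge \ u.coLarge).Nonempty := by
      rw [Finset.sdiff_nonempty]
      exact fun h => hne (Finset.eq_of_subset_of_card_le h cC.ge).symm
    rw [Finset.mem_sdiff] at hp hp' hq
    have hqe : q ∉ u.coLarge.erase p := fun h => hq.2 (Finset.mem_of_mem_erase h)
    have hX : (insert q (u.coLarge.erase p)).card = m := by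
      rw [Finset.card_insert_of_notMem hqe, Finset.card_erase_of_mem hp.1]
      omega
    have hXsub : insert q (u.coLarge.erase p) ⊆ u.coLarge ∪ v.coLarge :=
      Finset.insert_subset (Finset.mem_union_right _ hq.1)
        ((Finset.erase_subset _ _).trans Finset.subset_union_left)
    have hsmallX : Disjoint u.small (insert q (u.coLarge.erase p)) :=
      Disjoint.mono_right hXsub (Finset.disjoint_union_right.2
        ⟨u.disjoint_small_coLarge ham, hA ▸ v.disjoint_small_coLarge ham⟩)
    obtain ⟨x, hxs, hxl⟩ := exists_small_coLarge ha ham csu hX hsmallX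
    have hcapx : m - 1 ≤ (u.coLarge ∩ x.coLarge).card := by
      have h : u.coLarge.erase p ⊆ u.coLarge ∩ x.coLarge := by
        rw [hxl]
        exact Finset.subset_inter (Finset.erase_subset _ _) (Finset.subset_insert _ _)
      have := Finset.card_le_card h
      rw [Finset.card_erase_of_mem hp.1] at this
      omega
    have hcupx := Finset.card_union_add_card_inter u.coLarge x.coLarge
    have cx := x.card_coLarge
    have hcomp := Finset.card_compl (u.coLarge ∪ x.coLarge)
    rw [Fintype.card_fin] at hcomp
    have hp'x : p' ∈ x.coLarge := by
      rw [hxl]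
      exact Finset.mem_insert_of_mem (Finset.mem_erase.2 ⟨hpp', hp'.1⟩)
    obtain ⟨w, h1, h2, h3, -⟩ := exists_common_neighbor ha ham (u := u) (v := x) (P := {p'})
      (Q := u.small) (S := (u.coLarge ∪ x.coLarge)ᶜ) (by simpa using hp'.1)
      (by simpa using hp'x) (by simpa using ha) (by omega) subset_rfl hxs.le (by omega)
      (by
        rw [Finset.subset_compl_iff_disjoint_right, Finset.disjoint_union_right, hxl]
        exact ⟨u.disjoint_small_coLarge ham, hsmallX⟩)
      (disjoint_compl_left.mono_right Finset.subset_union_left)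
      (disjoint_compl_left.mono_right Finset.subset_union_right) (by omega)
    have := hmax x ?_ ?_ w h1 h2
    · rw [adj_iff ha ham] at this
      exact hp'.2 (this.2.2 (h3 (Finset.mem_singleton_self _)))
    · rintro rfl
      exact hq.2 (hxl ▸ Finset.mem_insert_self _ _)
    · intro w huw hvw
      rw [adj_iff ha ham] at huw hvw ⊢
      refine ⟨?_, hxs ▸ huw.2.1, ?_⟩
      · rw [hxl]
        exact Disjoint.mono_left hXsub (Finset.disjoint_union_left.2 ⟨huw.1, hvw.1⟩)
      · intro z hz
        rw [hxl]
        refine Finset.mem_insert_of_mem (Finset.mem_erase.2 ⟨?_, huw.2.2 hz⟩)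
        rintro rfl
        exact hp.2 (hvw.2.2 hz)
  · obtain ⟨y, hy⟩ : (v.small \ u.small).Nonempty := by
      rw [Finset.sdiff_nonempty]
      exact fun h => hA (Finset.eq_of_subset_of_card_le h cA.ge).symm
    by_cases hC : u.coLarge = v.coLarge
    · right
      refine ⟨hC, ?_⟩
      by_contra hcard
      obtain ⟨y', hy', hyy'⟩ : ∃ y' ∈ v.small \ u.small, y' ≠ y := by
        refine Finset.exists_mem_ne ?_ y
        have := Finset.card_pos.2 ⟨y, hy⟩
        rw [Finset.card_sdiff_comm cA.symm] at hcard
        omega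
      obtain ⟨p, hp⟩ : (u.small \ v.small).Nonempty := by
        rw [Finset.sdiff_nonempty]
        exact fun h => hA (Finset.eq_of_subset_of_card_le h cA.le)
      rw [Finset.mem_sdiff] at hy hy' hp
      have hye : y ∉ u.small.erase p := fun h => hy.2 (Finset.mem_of_mem_erase h)
      have hX : (insert y (u.small.erase p)).card = a := by
        rw [Finset.card_insert_of_notMem hye, Finset.card_erase_of_mem hp.1]
        omega
      have hXsub : insert y (u.small.erase p) ⊆ u.small ∪ v.small :=
        Finset.insert_subset (Finset.mem_union_right _ hy.1)
          ((Finset.erase_subset _ _).trans Finset.subset_union_left)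
      have hXd : Disjoint (insert y (u.small.erase p)) u.coLarge :=
        Disjoint.mono_left hXsub (Finset.disjoint_union_left.2
          ⟨u.disjoint_small_coLarge ham, hC ▸ v.disjoint_small_coLarge ham⟩)
      obtain ⟨x, hxs, hxl⟩ := exists_small_coLarge ha ham hX cu hXd
      have hcomp := Finset.card_compl u.coLarge
      rw [Fintype.card_fin] at hcomp
      have hle := Finset.pred_card_le_card_erase (s := u.coLargeᶜ) (a := y')
      obtain ⟨w, h1, h2, -, -, h3⟩ := exists_common_neighbor ha ham (u := u) (v := x) (P := ∅)
        (Q := insert y u.small) (S := u.coLargeᶜ.erase y') (Finset.empty_subset _)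
        (Finset.empty_subset _) (by simp) (by rw [hxl, Finset.inter_self]; omega)
        (Finset.subset_insert _ _)
        (by rw [hxs]; exact Finset.insert_subset_insert _ (Finset.erase_subset _ _))
        (by have := Finset.card_insert_le y u.small
            omega)
        (by
          rw [Finset.subset_erase, Finset.mem_insert, not_or]
          refine ⟨?_, hyy', hy'.2⟩
          rw [Finset.subset_compl_iff_disjoint_right, Finset.disjoint_insert_left]
          exact ⟨Finset.disjoint_left.1 (hC ▸ v.disjoint_small_coLarge ham) hy.1,
            u.disjoint_small_coLarge ham⟩)
        (disjoint_compl_left.mono_left (Finset.erase_subset _ _))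
        (hxl ▸ disjoint_compl_left.mono_left (Finset.erase_subset _ _)) (by omega)
      have := hmax x ?_ ?_ w h1 h2
      · rw [adj_iff ha ham] at this
        exact Finset.notMem_erase _ _ (h3 (this.2.1 hy'.1))
      · rintro rfl
        exact hy.2 (hxs ▸ Finset.mem_insert_self _ _)
      · intro w huw hvw
        rw [adj_iff ha ham] at huw hvw ⊢
        refine ⟨hxl ▸ huw.1, ?_, hxl ▸ huw.2.2⟩
        rw [hxs]
        exact hXsub.trans (Finset.union_subset huw.2.1 hvw.2.1)
    · exfalso
      rw [Finset.mem_sdiff] at hy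
      have hsd : Disjoint u.small v.coLarge := hdisj hu₀.2.1 hv₀.1
      obtain ⟨x, hxs, hxl⟩ := exists_small_coLarge ha ham csu v.card_coLarge hsd
      have hcomp := Finset.card_compl (u.coLarge ∪ v.coLarge)
      rw [Fintype.card_fin] at hcomp
      have hle := Finset.pred_card_le_card_erase (s := (u.coLarge ∪ v.coLarge)ᶜ) (a := y)
      obtain ⟨w, h1, h2, -, -, h3⟩ := exists_common_neighbor ha ham (u := u) (v := x) (P := ∅)
        (Q := u.small) (S := (u.coLarge ∪ v.coLarge)ᶜ.erase y) (Finset.empty_subset _)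
        (Finset.empty_subset _) (by simp) (by rwa [hxl]) subset_rfl hxs.le (by omega)
        (by
          rw [Finset.subset_erase, Finset.subset_compl_iff_disjoint_right,
            Finset.disjoint_union_right]
          exact ⟨⟨u.disjoint_small_coLarge ham, hsd⟩, hy.2⟩)
        ((disjoint_compl_left.mono_right Finset.subset_union_left).mono_left
          (Finset.erase_subset _ _))
        (hxl ▸ (disjoint_compl_left.mono_right Finset.subset_union_right).mono_left
          (Finset.erase_subset _ _)) (by omega)
      have := hmax x ?_ ?_ w h1 h2
      · rw [adj_iff ha ham] at this
        exact Finset.notMem_erase _ _ (h3 (this.2.1 hy.1))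
      · rintro rfl
        exact hC hxl
      · intro w huw hvw
        rw [adj_iff ha ham] at huw hvw ⊢
        exact ⟨hxl ▸ hvw.1, hxs ▸ huw.2.1, hxl ▸ hvw.2.2⟩

end FlagOfType

namespace FlagOfType

variable {m a : ℕ}

theorem ncard_maximallyClose_of_smallTwin (ha : 1 ≤ a) (ham : a < m)
    {u v : FlagOfType (3 * m) {a, 2 * m}} (h : SmallTwin u v) :
    {x | (generalPositionGraph (3 * m) {a, 2 * m}).MaximallyClose u x ∧
      (generalPositionGraph (3 * m) {a, 2 * m}).MaximallyClose v x}.ncard = 3 * m - a - 2 := by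
  obtain ⟨hA, hC⟩ := h
  have hne : u.coLarge ≠ v.coLarge := by
    intro h
    rw [h] at hC
    simp at hC
  have hmem : ∀ x, ((generalPositionGraph (3 * m) {a, 2 * m}).MaximallyClose u x ∧
      (generalPositionGraph (3 * m) {a, 2 * m}).MaximallyClose v x) ↔
      x.small = u.small ∧ (u.coLarge \ x.coLarge).card = 1 ∧
        (v.coLarge \ x.coLarge).card = 1 := by
    intro x
    rw [maximallyClose_iff ha ham, maximallyClose_iff ha ham]
    constructor
    · rintro ⟨⟨h1, h2⟩ | ⟨h1, h2⟩, ⟨h3, h4⟩ | ⟨h3, h4⟩⟩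
      · exact ⟨h1.symm, h2, h4⟩
      · rw [← hA, h1] at h4
        simp at h4
      · rw [hA, h3] at h2
        simp at h2
      · exact absurd (h1.trans h3.symm) hne
    · rintro ⟨h1, h2, h3⟩
      exact ⟨Or.inl ⟨h1.symm, h2⟩, Or.inl ⟨hA.symm.trans h1.symm, h3⟩⟩
  have hsub : ∀ x : FlagOfType (3 * m) {a, 2 * m}, x.small = u.small →
      x.coLarge ⊆ u.smallᶜ := by
    intro x hx
    rw [Finset.subset_compl_iff_disjoint_left, ← hx]
    exact x.disjoint_small_coLarge ham
  have hcard := Finset.card_filter_card_sdiff_eq_one (E := u.smallᶜ) (hsub u rfl)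
    (hsub v hA.symm) u.card_coLarge v.card_coLarge hC
  rw [Finset.card_compl, card_small, Fintype.card_fin] at hcard
  rw [← hcard, ← Set.ncard_coe_finset]
  refine Set.ncard_congr (fun x _ => x.coLarge) ?_ ?_ ?_
  · intro x hx
    obtain ⟨h1, h2, h3⟩ := (hmem x).1 hx
    rw [Finset.mem_coe, Finset.mem_filter, Finset.mem_powersetCard]
    exact ⟨⟨hsub x h1, x.card_coLarge⟩, h2, h3⟩
  · intro x y hx hy hxy
    exact ext' (((hmem x).1 hx).1.trans ((hmem y).1 hy).1.symm) hxy
  · intro Z hZ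
    rw [Finset.mem_coe, Finset.mem_filter, Finset.mem_powersetCard] at hZ
    obtain ⟨x, hx1, hx2⟩ := exists_small_coLarge ha ham u.card_small hZ.1.2
      (Finset.subset_compl_iff_disjoint_left.1 hZ.1.1)
    exact ⟨x, (hmem x).2 ⟨hx1, hx2 ▸ hZ.2.1, hx2 ▸ hZ.2.2⟩, hx2⟩

theorem ncard_maximallyClose_of_largeTwin (ha : 1 ≤ a) (ham : a < m)
    {u v : FlagOfType (3 * m) {a, 2 * m}} (h : LargeTwin u v) :
    {x | (generalPositionGraph (3 * m) {a, 2 * m}).MaximallyClose u x ∧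
      (generalPositionGraph (3 * m) {a, 2 * m}).MaximallyClose v x}.ncard = 2 * m - 2 := by
  obtain ⟨hC, hA⟩ := h
  have hne : u.small ≠ v.small := by
    intro h
    rw [h] at hA
    simp at hA
  have hmem : ∀ x, ((generalPositionGraph (3 * m) {a, 2 * m}).MaximallyClose u x ∧
      (generalPositionGraph (3 * m) {a, 2 * m}).MaximallyClose v x) ↔
      x.coLarge = u.coLarge ∧ (u.small \ x.small).card = 1 ∧
        (v.small \ x.small).card = 1 := by
    intro x
    rw [maximallyClose_iff ha ham, maximallyClose_iff ha ham]
    constructor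
    · rintro ⟨⟨h1, h2⟩ | ⟨h1, h2⟩, ⟨h3, h4⟩ | ⟨h3, h4⟩⟩
      · exact absurd (h1.trans h3.symm) hne
      · rw [hC, h3] at h2
        simp at h2
      · rw [← hC, h1] at h4
        simp at h4
      · exact ⟨h1.symm, h2, h4⟩
    · rintro ⟨h1, h2, h3⟩
      exact ⟨Or.inr ⟨h1.symm, h2⟩, Or.inr ⟨hC.symm.trans h1.symm, h3⟩⟩
  have hsub : ∀ x : FlagOfType (3 * m) {a, 2 * m}, x.coLarge = u.coLarge →
      x.small ⊆ u.coLargeᶜ := by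
    intro x hx
    rw [Finset.subset_compl_iff_disjoint_right, ← hx]
    exact x.disjoint_small_coLarge ham
  have hcard := Finset.card_filter_card_sdiff_eq_one (E := u.coLargeᶜ) (hsub u rfl)
    (hsub v hC.symm) u.card_small v.card_small hA
  rw [Finset.card_compl, card_coLarge, Fintype.card_fin,
    show 3 * m - m = 2 * m by omega] at hcard
  rw [← hcard, ← Set.ncard_coe_finset]
  refine Set.ncard_congr (fun x _ => x.small) ?_ ?_ ?_
  · intro x hx
    obtain ⟨h1, h2, h3⟩ := (hmem x).1 hx
    rw [Finset.mem_coe, Finset.mem_filter, Finset.mem_powersetCard]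
    exact ⟨⟨hsub x h1, x.card_small⟩, h2, h3⟩
  · intro x y hx hy hxy
    exact ext' hxy (((hmem x).1 hx).1.trans ((hmem y).1 hy).1.symm)
  · intro Z hZ
    rw [Finset.mem_coe, Finset.mem_filter, Finset.mem_powersetCard] at hZ
    obtain ⟨x, hx1, hx2⟩ := exists_small_coLarge ha ham hZ.1.2 u.card_coLarge
      (Finset.subset_compl_iff_disjoint_right.1 hZ.1.1)
    exact ⟨x, (hmem x).2 ⟨hx2, hx1 ▸ hZ.2.1, hx1 ▸ hZ.2.2⟩, hx1⟩

theorem SmallTwin.apply (ha : 1 ≤ a) (ham : a < m)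
    (α : GraphAut (generalPositionGraph (3 * m) {a, 2 * m}))
    {u v : FlagOfType (3 * m) {a, 2 * m}} (h : SmallTwin u v) : SmallTwin (α u) (α v) := by
  rcases (maximallyClose_iff ha ham).1 ((h.maximallyClose ha ham).apply α) with h' | h'
  · exact h'
  · have h1 := ncard_maximallyClose_of_smallTwin ha ham h
    have h2 := ncard_maximallyClose_of_largeTwin ha ham h'
    rw [SimpleGraph.ncard_maximallyClose_apply] at h2
    omega

theorem LargeTwin.apply (ha : 1 ≤ a) (ham : a < m)
    (α : GraphAut (generalPositionGraph (3 * m) {a, 2 * m}))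
    {u v : FlagOfType (3 * m) {a, 2 * m}} (h : LargeTwin u v) : LargeTwin (α u) (α v) := by
  rcases (maximallyClose_iff ha ham).1 ((h.maximallyClose ha ham).apply α) with h' | h'
  · have h1 := ncard_maximallyClose_of_largeTwin ha ham h
    have h2 := ncard_maximallyClose_of_smallTwin ha ham h'
    rw [SimpleGraph.ncard_maximallyClose_apply] at h2
    omega
  · exact h'

theorem eq_of_small_eq (ha : 1 ≤ a) (ham : a < m) {β : Type*}
    {F : FlagOfType (3 * m) {a, 2 * m} → β} (hF : ∀ x y, SmallTwin x y → F x = F y)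
    {u v : FlagOfType (3 * m) {a, 2 * m}} (h : u.small = v.small) : F u = F v := by
  let g : Finset (Fin (3 * m)) → Set β := fun Z =>
    F '' {x | x.small = u.small ∧ x.coLarge = Z}
  have hg : ∀ x, x.small = u.small → g x.coLarge = {F x} := by
    intro x hx
    have h : {y : FlagOfType (3 * m) {a, 2 * m} | y.small = u.small ∧ y.coLarge = x.coLarge} = {x} :=
      Set.ext fun y => ⟨fun hy => ext' (hy.1.trans hx.symm) hy.2, fun hy => by
        rw [Set.mem_singleton_iff.1 hy]
        exact ⟨hx, rfl⟩⟩
    exact (congrArg (F '' ·) h).trans Set.image_singleton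
  have hE : ∀ x : FlagOfType (3 * m) {a, 2 * m}, x.small = u.small →
      x.coLarge ⊆ u.smallᶜ := by
    intro x hx
    rw [Finset.subset_compl_iff_disjoint_left, ← hx]
    exact x.disjoint_small_coLarge ham
  have := Finset.eq_of_eq_of_card_sdiff_eq_one (E := u.smallᶜ) (g := g) (k := m) ?_
    (hE u rfl) (hE v h.symm) u.card_coLarge v.card_coLarge
  · rwa [hg u rfl, hg v h.symm, Set.singleton_eq_singleton_iff] at this
  · intro X Y hX hY hXm hYm hXY
    obtain ⟨x, hx, rfl⟩ := exists_small_coLarge ha ham u.card_small hXm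
      (Finset.subset_compl_iff_disjoint_left.1 hX)
    obtain ⟨y, hy, rfl⟩ := exists_small_coLarge ha ham u.card_small hYm
      (Finset.subset_compl_iff_disjoint_left.1 hY)
    rw [hg x hx, hg y hy, hF x y ⟨hx.trans hy.symm, hXY⟩]

theorem eq_of_coLarge_eq (ha : 1 ≤ a) (ham : a < m) {β : Type*}
    {F : FlagOfType (3 * m) {a, 2 * m} → β} (hF : ∀ x y, LargeTwin x y → F x = F y)
    {u v : FlagOfType (3 * m) {a, 2 * m}} (h : u.coLarge = v.coLarge) : F u = F v := by
  let g : Finset (Fin (3 * m)) → Set β := fun Z =>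
    F '' {x | x.coLarge = u.coLarge ∧ x.small = Z}
  have hg : ∀ x, x.coLarge = u.coLarge → g x.small = {F x} := by
    intro x hx
    have h : {y : FlagOfType (3 * m) {a, 2 * m} | y.coLarge = u.coLarge ∧ y.small = x.small} = {x} :=
      Set.ext fun y => ⟨fun hy => ext' hy.2 (hy.1.trans hx.symm), fun hy => by
        rw [Set.mem_singleton_iff.1 hy]
        exact ⟨hx, rfl⟩⟩
    exact (congrArg (F '' ·) h).trans Set.image_singleton
  have hE : ∀ x : FlagOfType (3 * m) {a, 2 * m}, x.coLarge = u.coLarge →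
      x.small ⊆ u.coLargeᶜ := by
    intro x hx
    rw [Finset.subset_compl_iff_disjoint_right, ← hx]
    exact x.disjoint_small_coLarge ham
  have := Finset.eq_of_eq_of_card_sdiff_eq_one (E := u.coLargeᶜ) (g := g) (k := a) ?_
    (hE u rfl) (hE v h.symm) u.card_small v.card_small
  · rwa [hg u rfl, hg v h.symm, Set.singleton_eq_singleton_iff] at this
  · intro X Y hX hY hXm hYm hXY
    obtain ⟨x, rfl, hx⟩ := exists_small_coLarge ha ham hXm u.card_coLarge
      (Finset.subset_compl_iff_disjoint_right.1 hX)
    obtain ⟨y, rfl, hy⟩ := exists_small_coLarge ha ham hYm u.card_coLarge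
      (Finset.subset_compl_iff_disjoint_right.1 hY)
    rw [hg x hx, hg y hy, hF x y ⟨hx.trans hy.symm, hXY⟩]

/-- An automorphism acts on the small members and on the complements of the large members. -/
theorem exists_action_on_members (ha : 1 ≤ a) (ham : a < m)
    (α : GraphAut (generalPositionGraph (3 * m) {a, 2 * m})) :
    ∃ σ τ : Finset (Fin (3 * m)) → Finset (Fin (3 * m)),
      ∀ x, (α x).small = σ x.small ∧ (α x).coLarge = τ x.coLarge := by
  have h1 : Function.FactorsThrough (fun x => (α x).small)
      (small : FlagOfType (3 * m) {a, 2 * m} → _) := fun x y h =>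
    eq_of_small_eq ha ham (F := fun x => (α x).small)
      (fun x y h => (h.apply ha ham α).1) h
  have h2 : Function.FactorsThrough (fun x => (α x).coLarge)
      (coLarge : FlagOfType (3 * m) {a, 2 * m} → _) := fun x y h =>
    eq_of_coLarge_eq ha ham (F := fun x => (α x).coLarge)
      (fun x y h => (h.apply ha ham α).1) h
  obtain ⟨σ, hσ⟩ := (Function.factorsThrough_iff _).1 h1
  obtain ⟨τ, hτ⟩ := (Function.factorsThrough_iff _).1 h2
  exact ⟨σ, τ, fun x => ⟨congrFun hσ x, congrFun hτ x⟩⟩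

theorem exists_small_eq (ha : 1 ≤ a) (ham : a < m) {A : Finset (Fin (3 * m))}
    (hA : A.card = a) : ∃ f : FlagOfType (3 * m) {a, 2 * m}, f.small = A := by
  obtain ⟨C, hC, hCm⟩ := Finset.exists_subset_card_eq (s := Aᶜ) (n := m)
    (by rw [Finset.card_compl, Fintype.card_fin]; omega)
  obtain ⟨f, hf, -⟩ := exists_small_coLarge ha ham hA hCm
    (Finset.subset_compl_iff_disjoint_left.1 hC)
  exact ⟨f, hf⟩

theorem exists_coLarge_eq (ha : 1 ≤ a) (ham : a < m) {C : Finset (Fin (3 * m))}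
    (hC : C.card = m) : ∃ f : FlagOfType (3 * m) {a, 2 * m}, f.coLarge = C := by
  obtain ⟨A, hA, hAa⟩ := Finset.exists_subset_card_eq (s := Cᶜ) (n := a)
    (by rw [Finset.card_compl, Fintype.card_fin]; omega)
  obtain ⟨f, -, hf⟩ := exists_small_coLarge ha ham hAa hC
    (Finset.subset_compl_iff_disjoint_right.1 hA)
  exact ⟨f, hf⟩

theorem exists_perm_of_graphAut (ha : 1 ≤ a) (ham : a < m)
    (α : GraphAut (generalPositionGraph (3 * m) {a, 2 * m})) :
    ∃ π : Equiv.Perm (Fin (3 * m)),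
      ∀ x, (α x).small = π • x.small ∧ (α x).coLarge = π • x.coLarge := by
  have key : ∀ β : GraphAut (generalPositionGraph (3 * m) {a, 2 * m}),
      ∀ σ τ : Finset (Fin (3 * m)) → Finset (Fin (3 * m)),
      (∀ x, (β x).small = σ x.small ∧ (β x).coLarge = τ x.coLarge) →
      ∀ A C : Finset (Fin (3 * m)), A.card = a → C.card = m → Disjoint A C →
        Disjoint (σ A) (τ C) := by
    intro β σ τ h A C hA hC hAC
    obtain ⟨x, rfl, rfl⟩ := exists_small_coLarge ha ham hA hC hAC
    rw [← (h x).1, ← (h x).2]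
    exact disjoint_small_coLarge ham _
  obtain ⟨σ, τ, h⟩ := exists_action_on_members ha ham α
  obtain ⟨σ', τ', h'⟩ := exists_action_on_members ha ham α.symm
  have hσ : ∀ A, A.card = a → (σ A).card = a := by
    intro A hA
    obtain ⟨x, rfl⟩ := exists_small_eq ha ham hA
    rw [← (h x).1, card_small]
  have hσ' : ∀ A, A.card = a → (σ' A).card = a := by
    intro A hA
    obtain ⟨x, rfl⟩ := exists_small_eq ha ham hA
    rw [← (h' x).1, card_small]
  have hτ : ∀ C, C.card = m → (τ C).card = m := by
    intro C hC
    obtain ⟨x, rfl⟩ := exists_coLarge_eq ha ham hC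
    rw [← (h x).2, card_coLarge]
  have hτ' : ∀ C, C.card = m → (τ' C).card = m := by
    intro C hC
    obtain ⟨x, rfl⟩ := exists_coLarge_eq ha ham hC
    rw [← (h' x).2, card_coLarge]
  have hσσ' : ∀ A, A.card = a → σ (σ' A) = A := by
    intro A hA
    obtain ⟨x, rfl⟩ := exists_small_eq ha ham hA
    rw [← (h' x).1, ← (h _).1, RelIso.apply_symm_apply]
  have hσ'σ : ∀ A, A.card = a → σ' (σ A) = A := by
    intro A hA
    obtain ⟨x, rfl⟩ := exists_small_eq ha ham hA
    rw [← (h x).1, ← (h' _).1, RelIso.symm_apply_apply]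
  have hττ' : ∀ C, C.card = m → τ (τ' C) = C := by
    intro C hC
    obtain ⟨x, rfl⟩ := exists_coLarge_eq ha ham hC
    rw [← (h' x).2, ← (h _).2, RelIso.apply_symm_apply]
  have hτ'τ : ∀ C, C.card = m → τ' (τ C) = C := by
    intro C hC
    obtain ⟨x, rfl⟩ := exists_coLarge_eq ha ham hC
    rw [← (h x).2, ← (h' _).2, RelIso.symm_apply_apply]
  obtain ⟨π, h1, h2⟩ := Finset.exists_perm_of_disjoint_iff ha (by omega)
    (by rw [Fintype.card_fin]; omega) hσ hσ' hσσ' hσ'σ hτ hτ' hττ' hτ'τ (by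
      intro A C hA hC
      refine ⟨key α σ τ h A C hA hC, fun hd => ?_⟩
      have := key α.symm σ' τ' h' _ _ (hσ A hA) (hτ C hC) hd
      rwa [hσ'σ A hA, hτ'τ C hC] at this)
  exact ⟨π, fun x => ⟨by rw [(h x).1, h1 _ x.card_small], by rw [(h x).2, h2 _ x.card_coLarge]⟩⟩

end FlagOfType

section PermAction

variable {n : ℕ} {T : Finset ℕ}

theorem FlagOfType.smul_isFlag (π : Equiv.Perm (Fin n)) {f : Finset (Finset (Fin n))}
    (hf : IsFlag f ∧ flagType f = T) : IsFlag (π • f) ∧ flagType (π • f) = T := by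
  refine ⟨⟨?_, ?_⟩, ?_⟩
  · intro A hA
    obtain ⟨X, hX, rfl⟩ := Finset.mem_smul_finset.1 hA
    refine ⟨(hf.1.1 X hX).1.smul_finset, fun h => (hf.1.1 X hX).2 ?_⟩
    rw [← Finset.smul_finset_univ (a := π)] at h
    exact smul_left_cancel π h
  · intro A hA B hB
    obtain ⟨X, hX, rfl⟩ := Finset.mem_smul_finset.1 hA
    obtain ⟨Y, hY, rfl⟩ := Finset.mem_smul_finset.1 hB
    rw [Finset.smul_finset_subset_smul_finset_iff, Finset.smul_finset_subset_smul_finset_iff]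
    exact hf.1.2 X hX Y hY
  · rw [← hf.2]
    ext k
    simp only [flagType, Finset.mem_image, Finset.mem_smul_finset]
    constructor
    · rintro ⟨_, ⟨A, hA, rfl⟩, rfl⟩
      exact ⟨A, hA, (Finset.card_smul_finset _ _).symm⟩
    · rintro ⟨A, hA, rfl⟩
      exact ⟨_, ⟨A, hA, rfl⟩, Finset.card_smul_finset _ _⟩

instance : MulAction (Equiv.Perm (Fin n)) (FlagOfType n T) where
  smul π f := ⟨π • f.1, FlagOfType.smul_isFlag π f.2⟩
  one_smul f := Subtype.ext (one_smul _ f.1)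
  mul_smul π ρ f := Subtype.ext (mul_smul π ρ f.1)

theorem FlagOfType.coe_smul (π : Equiv.Perm (Fin n)) (f : FlagOfType n T) :
    (π • f).1 = π • f.1 := rfl

theorem InGeneralPosition.smul (π : Equiv.Perm (Fin n)) {f g : Finset (Finset (Fin n))}
    (h : InGeneralPosition f g) : InGeneralPosition (π • f) (π • g) := by
  intro A hA B hB
  obtain ⟨X, hX, rfl⟩ := Finset.mem_smul_finset.1 hA
  obtain ⟨Y, hY, rfl⟩ := Finset.mem_smul_finset.1 hB
  rw [← Finset.smul_finset_inter, ← Finset.smul_finset_union]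
  rcases h X hX Y hY with h | h
  · left
    rw [h, Finset.smul_finset_empty]
  · right
    rw [h, Finset.smul_finset_univ]

theorem generalPositionGraph_adj_smul (π : Equiv.Perm (Fin n)) {f g : FlagOfType n T}
    (h : (generalPositionGraph n T).Adj f g) :
    (generalPositionGraph n T).Adj (π • f) (π • g) :=
  ⟨fun e => h.1 (smul_left_cancel π e), h.2.smul π⟩

/-- The action of the permutations of the points on the general position graph. -/
def permGraphAut (n : ℕ) (T : Finset ℕ) :
    Equiv.Perm (Fin n) →* GraphAut (generalPositionGraph n T) where
  toFun π := ⟨MulAction.toPerm π, fun {f g} => ⟨fun h => by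
    have := generalPositionGraph_adj_smul π⁻¹ h
    simpa using this, generalPositionGraph_adj_smul π⟩⟩
  map_one' := by
    exact RelIso.ext fun f => one_smul (Equiv.Perm (Fin n)) f
  map_mul' π ρ := by
    exact RelIso.ext fun f => mul_smul π ρ f

theorem permGraphAut_apply (π : Equiv.Perm (Fin n)) (f : FlagOfType n T) :
    permGraphAut n T π f = π • f := rfl

theorem permGraphAut_smul (π : Equiv.Perm (Fin n)) (f : FlagOfType n T) :
    permGraphAut n T π • f = π • f := rfl

theorem permGraphAut_smul_flagsThrough (π : Equiv.Perm (Fin n)) (X : Finset (Fin n)) :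
    permGraphAut n T π • flagsThrough n T X = flagsThrough n T (π • X) := by
  ext f
  rw [Set.mem_smul_set_iff_inv_smul_mem, ← map_inv, permGraphAut_smul]
  change X ∈ π⁻¹ • f.1 ↔ π • X ∈ f.1
  rw [Finset.mem_inv_smul_finset_iff]

end PermAction

theorem Finset.exists_perm_smul_eq_smul_eq {ι : Type*} [Fintype ι] [DecidableEq ι]
    {A C A' C' : Finset ι} (hAC : Disjoint A C) (hAC' : Disjoint A' C') (hA : A.card = A'.card)
    (hC : C.card = C'.card) : ∃ π : Equiv.Perm ι, π • A = A' ∧ π • C = C' := by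
  have hfib : ∀ k : Bool × Bool,
      Fintype.card {x // (decide (x ∈ A), decide (x ∈ C)) = k} =
        Fintype.card {x // (decide (x ∈ A'), decide (x ∈ C')) = k} := by
    have inter : ∀ {P Q : Finset ι}, Disjoint P Q → ∀ x, ¬ (x ∈ P ∧ x ∈ Q) :=
      fun h x hx => Finset.disjoint_left.1 h hx.1 hx.2
    have only_left : ∀ {P Q : Finset ι}, Disjoint P Q → ∀ x, (x ∈ P ∧ x ∉ Q) ↔ x ∈ P :=
      fun h x => ⟨fun hx => hx.1, fun hx => ⟨hx, Finset.disjoint_left.1 h hx⟩⟩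
    have only_right : ∀ {P Q : Finset ι}, Disjoint P Q → ∀ x, (x ∉ P ∧ x ∈ Q) ↔ x ∈ Q :=
      fun h x => ⟨fun hx => hx.2, fun hx => ⟨Finset.disjoint_right.1 h hx, hx⟩⟩
    have neither : ∀ {P Q : Finset ι} (x), (x ∉ P ∧ x ∉ Q) ↔ x ∈ (P ∪ Q)ᶜ := by
      intro P Q x
      rw [Finset.mem_compl, Finset.mem_union, not_or]
    rintro ⟨_ | _, _ | _⟩ <;> rw [Fintype.card_subtype, Fintype.card_subtype] <;>
      simp only [Prod.mk.injEq, decide_eq_true_eq, decide_eq_false_iff_not]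
    · simp only [neither, Finset.filter_univ_mem]
      rw [Finset.card_compl, Finset.card_compl, Finset.card_union_of_disjoint hAC,
        Finset.card_union_of_disjoint hAC', hA, hC]
    · simpa only [only_right hAC, only_right hAC', Finset.filter_univ_mem]
    · simpa only [only_left hAC, only_left hAC', Finset.filter_univ_mem]
    · simp only [inter hAC, inter hAC']
  let π : Equiv.Perm ι := Equiv.ofFiberEquiv fun k => Fintype.equivOfCardEq (hfib k)
  have hπ : ∀ x, (decide (π x ∈ A'), decide (π x ∈ C')) = (decide (x ∈ A), decide (x ∈ C)) :=
    Equiv.ofFiberEquiv_map (fun k => Fintype.equivOfCardEq (hfib k))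
  simp only [Prod.mk.injEq, decide_eq_decide] at hπ
  refine ⟨π, ?_, ?_⟩
  · refine Finset.eq_of_subset_of_card_le (fun y hy => ?_) (by rw [card_smul_finset, hA])
    obtain ⟨x, hx, rfl⟩ := Finset.mem_smul_finset.1 hy
    exact (hπ x).1.2 hx
  · refine Finset.eq_of_subset_of_card_le (fun y hy => ?_) (by rw [card_smul_finset, hC])
    obtain ⟨x, hx, rfl⟩ := Finset.mem_smul_finset.1 hy
    exact (hπ x).2.2 hx

namespace FlagOfType

variable {m a : ℕ}

theorem small_smul (π : Equiv.Perm (Fin (3 * m))) (f : FlagOfType (3 * m) {a, 2 * m}) :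
    (π • f).small = π • f.small := by
  refine ((π • f).eq_member _ ?_ (by rw [Finset.card_smul_finset, card_small])).symm
  rw [coe_smul, Finset.smul_mem_smul_finset_iff]
  exact f.member_mem _

theorem coLarge_smul (π : Equiv.Perm (Fin (3 * m))) (f : FlagOfType (3 * m) {a, 2 * m}) :
    (π • f).coLarge = π • f.coLarge := by
  rw [coLarge, coLarge, Finset.compl_eq_univ_sdiff, Finset.compl_eq_univ_sdiff,
    Finset.smul_finset_sdiff, Finset.smul_finset_univ]
  congr 1
  refine ((π • f).eq_member _ ?_ (by rw [Finset.card_smul_finset, card_member])).symm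
  rw [coe_smul, Finset.smul_mem_smul_finset_iff]
  exact f.member_mem _

theorem permGraphAut_surjective (ha : 1 ≤ a) (ham : a < m) :
    Function.Surjective (permGraphAut (3 * m) {a, 2 * m}) := by
  intro α
  obtain ⟨π, hπ⟩ := exists_perm_of_graphAut ha ham α
  refine ⟨π, RelIso.ext fun x => ?_⟩
  rw [permGraphAut_apply]
  exact ext' (by rw [small_smul, (hπ x).1]) (by rw [coLarge_smul, (hπ x).2])

theorem permGraphAut_injective (ha : 1 ≤ a) (ham : a < m) :
    Function.Injective (permGraphAut (3 * m) {a, 2 * m}) := by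
  rw [injective_iff_map_eq_one]
  intro π hπ
  have hfix : ∀ A : Finset (Fin (3 * m)), A.card = a → π • A = A := by
    intro A hA
    obtain ⟨f, rfl⟩ := exists_small_eq ha ham hA
    rw [← small_smul, ← permGraphAut_apply, hπ, RelIso.one_apply]
  ext1 x
  by_contra hx
  obtain ⟨A, hA, hxA, hd⟩ := Finset.exists_card_eq_mem_disjoint (k := a) (U := {π x}) (x := x)
    ha (by simpa using fun h : x = π x => hx h.symm)
    (by rw [Finset.card_singleton, Fintype.card_fin]; omega)
  refine Finset.disjoint_left.1 hd (Finset.mem_singleton_self _) ?_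
  rw [← hfix A hA]
  exact Finset.smul_mem_smul_finset hxA

theorem isPretransitive_graphAut (ham : a < m) :
    MulAction.IsPretransitive (GraphAut (generalPositionGraph (3 * m) {a, 2 * m}))
      (FlagOfType (3 * m) {a, 2 * m}) := by
  refine ⟨fun f g => ?_⟩
  obtain ⟨π, h1, h2⟩ := Finset.exists_perm_smul_eq_smul_eq (f.disjoint_small_coLarge ham)
    (g.disjoint_small_coLarge ham) (by rw [card_small, card_small])
    (by rw [card_coLarge, card_coLarge])
  refine ⟨permGraphAut _ _ π, ?_⟩
  rw [permGraphAut_smul]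
  exact ext' (by rw [small_smul, h1]) (by rw [coLarge_smul, h2])

/-- If every flag contains exactly one `k`-set and some two flags share it while some two do not,
then the sets of flags through the `k`-sets form a system of nontrivial blocks. -/
theorem isNontrivialBlockSystem_flagsThrough (ha : 1 ≤ a) (ham : a < m) {k : ℕ}
    (hk : k ∈ ({a, 2 * m} : Finset ℕ)) {f₁ f₂ f₃ : FlagOfType (3 * m) {a, 2 * m}}
    (h₁₂ : f₁ ≠ f₂) (hm₁₂ : f₁.member hk = f₂.member hk)
    (hm₁₃ : f₁.member hk ≠ f₃.member hk) :
    IsNontrivialBlockSystem (GraphAut (generalPositionGraph (3 * m) {a, 2 * m}))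
      {Y : Set (FlagOfType (3 * m) {a, 2 * m}) |
        ∃ A : Finset (Fin (3 * m)), A.card = k ∧ Y = flagsThrough (3 * m) {a, 2 * m} A} := by
  have hmem : ∀ (f : FlagOfType (3 * m) {a, 2 * m}) {X : Finset (Fin (3 * m))}, X.card = k →
      (f ∈ flagsThrough (3 * m) {a, 2 * m} X ↔ X = f.member hk) := fun f X hX =>
    ⟨fun h => f.eq_member hk h hX, fun h => h ▸ f.member_mem hk⟩
  have hc := f₁.card_member hk
  refine ⟨isPretransitive_graphAut ham, flagsThrough _ _ (f₁.member hk),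
    ⟨f₁, f₁.member_mem hk⟩, ?_, ?_, ?_⟩
  · rw [MulAction.isBlock_iff_smul_eq_smul_of_nonempty]
    intro g₁ g₂ hne
    obtain ⟨π, rfl⟩ := permGraphAut_surjective ha ham g₁
    obtain ⟨ρ, rfl⟩ := permGraphAut_surjective ha ham g₂
    rw [permGraphAut_smul_flagsThrough, permGraphAut_smul_flagsThrough] at hne ⊢
    obtain ⟨f, hf, hf'⟩ := hne
    rw [hmem f (by rw [Finset.card_smul_finset, hc])] at hf hf'
    rw [hf, hf']
  · rintro (h | h)
    · exact h₁₂ (h (f₁.member_mem hk) ((hmem f₂ hc).2 hm₁₂))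
    · exact hm₁₃ ((hmem f₃ hc).1 (h ▸ Set.mem_univ f₃))
  · ext Y
    constructor
    · rintro ⟨A, hA, rfl⟩
      obtain ⟨π, hπ, -⟩ := Finset.exists_perm_smul_eq_smul_eq (A := f₁.member hk) (A' := A)
        (Finset.disjoint_empty_right _) (Finset.disjoint_empty_right _) (hc.trans hA.symm) rfl
      exact ⟨permGraphAut _ _ π, by rw [permGraphAut_smul_flagsThrough, hπ]⟩
    · rintro ⟨g, rfl⟩
      obtain ⟨π, rfl⟩ := permGraphAut_surjective ha ham g
      exact ⟨π • f₁.member hk, by rw [Finset.card_smul_finset, hc],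
        permGraphAut_smul_flagsThrough _ _⟩

theorem exists_small_eq_coLarge_ne (ha : 1 ≤ a) (ham : a < m) :
    ∃ u v : FlagOfType (3 * m) {a, 2 * m}, u.small = v.small ∧ u.coLarge ≠ v.coLarge := by
  obtain ⟨A, -, hA⟩ := Finset.exists_subset_card_eq (s := (Finset.univ : Finset (Fin (3 * m))))
    (n := a) (by rw [Finset.card_univ, Fintype.card_fin]; omega)
  obtain ⟨u, rfl⟩ := exists_small_eq ha ham hA
  obtain ⟨x, hx⟩ := Finset.card_pos.1 (by rw [card_coLarge]; omega : 0 < u.coLarge.card)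
  obtain ⟨C, hC, hCm⟩ := Finset.exists_subset_card_eq (s := (u.small ∪ u.coLarge)ᶜ) (n := m) (by
    rw [Finset.card_compl, Finset.card_union_of_disjoint (u.disjoint_small_coLarge ham),
      card_small, card_coLarge, Fintype.card_fin]
    omega)
  have hd := Finset.subset_compl_iff_disjoint_left.1 hC
  rw [Finset.disjoint_union_left] at hd
  obtain ⟨v, hv, rfl⟩ := exists_small_coLarge ha ham hA hCm hd.1
  exact ⟨u, v, hv.symm, fun h => Finset.disjoint_left.1 hd.2 hx (h ▸ hx)⟩

theorem exists_coLarge_eq_small_ne (ha : 1 ≤ a) (ham : a < m) :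
    ∃ u v : FlagOfType (3 * m) {a, 2 * m}, u.coLarge = v.coLarge ∧ u.small ≠ v.small := by
  obtain ⟨u, -⟩ := exists_small_eq_coLarge_ne ha ham
  obtain ⟨x, hx⟩ := Finset.card_pos.1 (by rw [card_small]; omega : 0 < u.small.card)
  obtain ⟨A, hA, hAa⟩ := Finset.exists_subset_card_eq (s := (u.small ∪ u.coLarge)ᶜ) (n := a) (by
    rw [Finset.card_compl, Finset.card_union_of_disjoint (u.disjoint_small_coLarge ham),
      card_small, card_coLarge, Fintype.card_fin]
    omega)
  have hd := Finset.subset_compl_iff_disjoint_left.1 hA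
  rw [Finset.disjoint_union_left] at hd
  obtain ⟨v, rfl, hv⟩ := exists_small_coLarge ha ham hAa u.card_coLarge hd.2.symm
  exact ⟨u, v, hv.symm, fun h => Finset.disjoint_left.1 hd.1 hx (h ▸ hx)⟩

end FlagOfType

theorem lemma3p6 (n a b : ℕ) (hT : ({a, b} : Finset ℕ) ⊆ Finset.Icc 1 (n - 1))
    (ha : (a : ℝ) ≤ (n : ℝ) / 3 - 1) (hb : (b : ℝ) = 2 * (n : ℝ) / 3) :
    (IsNontrivialBlockSystem (GraphAut (generalPositionGraph n {a, b}))
        {Y : Set (FlagOfType n {a, b}) |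
          ∃ A : Finset (Fin n), A.card = a ∧ Y = flagsThrough n {a, b} A} ∧
      IsNontrivialBlockSystem (GraphAut (generalPositionGraph n {a, b}))
        {Y : Set (FlagOfType n {a, b}) |
          ∃ B : Finset (Fin n), B.card = b ∧ Y = flagsThrough n {a, b} B}) ∧
    Nonempty (GraphAut (generalPositionGraph n {a, b}) ≃* Equiv.Perm (Fin n)) := by
  have ha1 : 1 ≤ a := (Finset.mem_Icc.1 (hT (Finset.mem_insert_self a _))).1
  have hb' : 3 * b = 2 * n := by
    have : (3 : ℝ) * b = 2 * n := by linarith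
    exact_mod_cast this
  have ha' : 3 * a + 3 ≤ n := by
    have : (3 : ℝ) * a + 3 ≤ n := by linarith
    exact_mod_cast this
  obtain ⟨m, rfl⟩ : ∃ m, n = 3 * m := ⟨n - b, by omega⟩
  obtain rfl : b = 2 * m := by omega
  have ham : a < m := by omega
  clear hT ha hb hb' ha'
  obtain ⟨u, v, huv, huv'⟩ := FlagOfType.exists_small_eq_coLarge_ne ha1 ham
  obtain ⟨s, t, hst, hst'⟩ := FlagOfType.exists_coLarge_eq_small_ne ha1 ham
  refine ⟨⟨?_, ?_⟩, ?_⟩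
  · obtain ⟨w, hw⟩ : ∃ w : FlagOfType (3 * m) {a, 2 * m}, u.small ≠ w.small := by
      by_contra! h
      exact hst' ((h s).symm.trans (h t))
    exact FlagOfType.isNontrivialBlockSystem_flagsThrough ha1 ham (by simp)
      (fun h => huv' (congrArg _ h)) huv hw
  · obtain ⟨w, hw⟩ : ∃ w : FlagOfType (3 * m) {a, 2 * m}, s.coLarge ≠ w.coLarge := by
      by_contra! h
      exact huv' ((h u).symm.trans (h v))
    exact FlagOfType.isNontrivialBlockSystem_flagsThrough ha1 ham (by simp)
      (fun h => hst' (congrArg _ h)) (compl_injective hst) (fun h => hw (congrArg compl h))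
  · exact ⟨(MulEquiv.ofBijective (permGraphAut (3 * m) {a, 2 * m})
      ⟨FlagOfType.permGraphAut_injective ha1 ham,
        FlagOfType.permGraphAut_surjective ha1 ham⟩).symm⟩
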